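/- Let $n\ge 1$ and let $\Omega\subseteq\{0,\dots,n-1\}$ be a fixed index set with $|\Omega|=m$. Let $\mathbf g\sim\mathcal N(0,I_n)$, let $\boldsymbol\xi$ be a sequence of $n$ independent Rademacher variables, put $\mathbf C_{\mathbf g}(i,j)=g_{(j-i)\bmod n}$ and $\mathbf D_{\boldsymbol\xi}=\mathrm{diag}(\boldsymbol\xi)$, and let $\mathbf R_\Omega$ be the restriction to the coordinates in $\Omega$. Set $\tilde{\mathbf A}=\mathbf R_\Omega\mathbf C_{\mathbf g}\in\mathbb R^{m\times n}$, $\mathbf A=\tilde{\mathbf A}\mathbf D_{\boldsymbol\xi}$ and $\tilde{\mathbf x}^*=\mathbf D_{\boldsymbol\xi}\mathbf x^*$, where $\mathbf x^*\in\mathbb R^n$ is a fixed vector with $\|\mathbf x^*\|_2=1$. Let $b_i=\theta_i(\langle\mathbf a_i,\mathbf x^*\rangle)$, $i\in\Omega$, where $\mathbf a_i^T$ are the rows of $\mathbf A$ and $\theta_i$ are i.i.d. copies of a random function $\theta$ of one of the following two kinds: * $\theta(z)=\tau\,\mathrm{sign}(z)$ with $\tau\in\{-1,1\}$ random, $\mathbb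 P(\tau=-1)=p<\tfrac12$; * $\theta(z)=\mathrm{sign}(z+e)$ with $e$ a real random variable whose distribution function satisfies $F_e(z)+F_e(-z)=1$ for all $z\in\mathbb R$. The three families $\mathbf g$, $\boldsymbol\xi$ and the noise variables ($\tau_i$ or $e_i$) are independent of each other. Let $\lambda=\mathbb E[\theta(g)g]$ with $g\sim\mathcal N(0,1)$ independent of $\theta$. Then for all constants $K_0,K_1>0$ there are constants $C,c>0$, depending on $K_0,K_1$ only, such that the following holds. Whenever $t>0$, $m\ge K_0(t+\log n)$ and $\|\mathbf x^*\|_\infty\le\rho$ with $\rho\le\dfrac{K_1}{m(t+\log m)}$, with probability at least $1-e^{-ct}-e^{-c\sqrt m}$, $$\Big\|\frac1m\tilde{\mathbf A}^T\mathbf b-\lambda\tilde{\mathbf x}^*\Big\|_\infty\le C\sqrt{\frac{t+\log n}{m}}.$$ -/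

import Mathlib

open MeasureTheory ProbabilityTheory
open scoped Matrix

noncomputable section

namespace OneBitCirc

/-- The sign function with values in `{-1, 1}` (the value at `0` is irrelevant: it is taken with
probability zero). -/
def sgn (x : ℝ) : ℝ := if 0 ≤ x then 1 else -1

/-- The law of a `±1`-valued random variable that equals `-1` with probability `p`. -/
def signLaw (p : ℝ) : Measure ℝ :=
  ENNReal.ofReal p • Measure.dirac (-1) + ENNReal.ofReal (1 - p) • Measure.dirac 1

/-- The law of a Rademacher variable. -/
def rademacher : Measure ℝ := signLaw (1 / 2)

/-- The circulant matrix `C_g` with entries `C_g(i, j) = g_{j - i}`, indices modulo `n`. -/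
def circ {n : ℕ} (g : Fin n → ℝ) : Matrix (Fin n) (Fin n) ℝ :=
  Matrix.of fun i j => g (j - i)

/-- The partial circulant matrix `R_S C_g`: the rows of `C_g` indexed by `S`. -/
def partialCirc {n : ℕ} (S : Finset (Fin n)) (g : Fin n → ℝ) : Matrix S (Fin n) ℝ :=
  (circ g).submatrix (fun i : S => (i : Fin n)) id

/-- The sensing matrix `A = R_S C_g D_ξ`, a partial circulant matrix with column sign flips. -/
def sensing {n : ℕ} (S : Finset (Fin n)) (g ξ : Fin n → ℝ) : Matrix S (Fin n) ℝ :=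
  partialCirc S g * Matrix.diagonal ξ

/-- A random function `θ` with values in `{-1, 1}` is given by a deterministic map `(w, z) ↦ Θ w z`
and the law `ν` of the random parameter `w`. The two observation models are
* random bit flips: `θ(z) = τ * sign z`, where `τ = ±1` and `P(τ = -1) = p < 1/2`;
* random noise before quantization: `θ(z) = sign (z + e)`, where the cumulative distribution
  function `F` of the noise `e` satisfies `F(x) + F(-x) = 1` for all `x`. -/
inductive IsOneBitModel : (ℝ → ℝ → ℝ) → Measure ℝ → Prop
  | bitFlip (p : ℝ) (hp0 : 0 ≤ p) (hp : p < 1 / 2) :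
      IsOneBitModel (fun τ z => τ * sgn z) (signLaw p)
  | additive (ν : Measure ℝ) (hν : IsProbabilityMeasure ν)
      (hsymm : ∀ x : ℝ, cdf ν x + cdf ν (-x) = 1) :
      IsOneBitModel (fun e z => sgn (z + e)) ν

/-- The parameter `λ = E[θ(g) g]`, where `g` is standard normal and independent of `θ`. -/
def corr (Θ : ℝ → ℝ → ℝ) (ν : Measure ℝ) : ℝ :=
  ∫ q : ℝ × ℝ, Θ q.1 q.2 * q.2 ∂(ν.prod (gaussianReal 0 1))

/-- The observations `b = θ(A x)`, with a separate noise variable `w i` in every coordinate. -/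
def obs {n : ℕ} (S : Finset (Fin n)) (Θ : ℝ → ℝ → ℝ) (x ξ g : Fin n → ℝ) (w : S → ℝ) : S → ℝ :=
  fun i => Θ (w i) ((sensing S g ξ *ᵥ x) i)

/-- The joint law of `(ξ, g, w)`: `ξ` is a Rademacher sequence, `g` a standard Gaussian vector, `w`
a sequence of i.i.d. noise variables with law `ν`, and the three are independent. -/
def jointLaw {n : ℕ} (S : Finset (Fin n)) (ν : Measure ℝ) :
    Measure ((Fin n → ℝ) × (Fin n → ℝ) × (S → ℝ)) :=
  (Measure.pi fun _ => rademacher).prod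
    ((Measure.pi fun _ => gaussianReal 0 1).prod (Measure.pi fun _ => ν))

end OneBitCirc

end

/-!
Since `ρ ≤ K₁ / (m (t + log m))`, the vector `λ x̃` is itself smaller than the permitted error, so
the point is to show that every coordinate `F_l = ∑ i ∈ S, b i * g (l - i)` of `Ãᵀ b` is of order
`√(m (t + log n))`. With `x̃ = D_ξ x` and `u_i j = x̃ (j + i)` the measurements are
`⟨a_i, x⟩ = ⟨g, u_i⟩`. The argument has three parts.

*Randomness of the column signs.* The inner products `⟨u_i, u_k⟩`, `i ≠ k`, are Rademacher chaoses
`∑ j, x j x (j + d) ξ_j ξ_{j+d}`. They split into two Rademacher martingale transforms and are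
therefore sub-Gaussian with variance proxy `ρ ^ 2` (`measure_shift_chaos_ge_le`). Hence with high
probability they are at most `1 / (2 m)`, and the Gram matrix `G` of the `u_i` satisfies
`‖G - 1‖_F ≤ 1 / 2` (`measure_shiftRows_gram_ge_le`).

*Decorrelation.* For such signs the Gaussian vector `g` is replaced by `A g`, where `A` rescales the
principal directions of the `u_i` so that the measurements become independent standard Gaussians.
The second moment of the density ratio is `∏ (1 - (μ_k - 1)²)^{-1/2}` over the eigenvalues `μ_k` of
`G`, which is bounded because `∑ (μ_k - 1)² = ‖G - 1‖_F²`; by the Cauchy–Schwarz inequality the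
probability of an event changes at most by a constant factor and a square root
(`exists_decorrelation`).

*Exponential moments for independent measurements.* Splitting `E exp (s F_l)` according to the
pattern `σ` of the output bits and applying the Cameron–Martin formula to each piece gives, up to a
factor `exp (s² m)`, the sum over `σ` of the probabilities that measurements shifted by `c(σ)`, a
multiple `s` of a linear image of `σ`, have output bits `σ`. A shift by `c` changes the probability
`1 / 2` of a bit by a factor at most `1 + |c|`, because both observation models are symmetric. The
sum is thus bounded by the mean of `exp (∑ i, |c_i(σ)|)` over uniform `σ`, which Jensen's inequality
reduces to moment generating functions of Rademacher sums. So `F_l` is sub-Gaussian with variance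
proxy of order `m` (`IsOneBitModel.measure_abs_bits_ge_le`), and a union bound over `l` concludes.

When `m` is bounded in terms of `K₁`, the condition `m ≥ K₀ (t + log n)` bounds `t` as well, and the
claimed probability is not positive for small `c`.
-/

open scoped ENNReal NNReal

namespace OneBitCirc

/-! ### Gaussian product measures: tilting, rotation and rescaling -/

lemma lintegral_pi_prod {ι : Type*} [Fintype ι] {X : ι → Type*} [∀ i, MeasurableSpace (X i)]
    (μ : ∀ i, Measure (X i)) [∀ i, IsProbabilityMeasure (μ i)]
    (f : ∀ i, X i → ℝ≥0∞) (hf : ∀ i, Measurable (f i)) :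
    ∫⁻ z, ∏ i, f i (z i) ∂(Measure.pi μ) = ∏ i, ∫⁻ x, f i x ∂(μ i) := by
  have h := lintegral_prod_eq_prod_lintegral_of_indepFun Finset.univ
    (fun i (z : ∀ i, X i) => f i (z i))
    (iIndepFun_pi (μ := μ) (X := f) fun i => (hf i).aemeasurable)
    (fun i => (hf i).comp (measurable_pi_apply i))
  rw [h]
  refine Finset.prod_congr rfl fun i _ => ?_
  exact (measurePreserving_eval μ i).lintegral_comp (hf i)

lemma pi_withDensity {ι : Type*} [Fintype ι] {X : ι → Type*} [∀ i, MeasurableSpace (X i)]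
    (μ : ∀ i, Measure (X i)) [∀ i, IsProbabilityMeasure (μ i)]
    (r : ∀ i, X i → ℝ≥0∞) (hr : ∀ i, Measurable (r i))
    [∀ i, IsProbabilityMeasure ((μ i).withDensity (r i))] :
    Measure.pi (fun i => (μ i).withDensity (r i)) =
      (Measure.pi μ).withDensity (fun z => ∏ i, r i (z i)) := by
  refine Measure.pi_eq fun s hs => ?_
  rw [withDensity_apply _ (MeasurableSet.univ_pi hs),
    ← lintegral_indicator (MeasurableSet.univ_pi hs)]
  have : (fun z : ∀ i, X i => (Set.univ.pi s).indicator (fun z => ∏ i, r i (z i)) z) =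
      fun z => ∏ i, (s i).indicator (r i) (z i) := by
    funext z
    by_cases hz : z ∈ Set.univ.pi s
    · rw [Set.indicator_of_mem hz]
      exact Finset.prod_congr rfl fun i _ =>
        (Set.indicator_of_mem (hz i (Set.mem_univ i)) _).symm
    · rw [Set.indicator_of_notMem hz]
      simp only [Set.mem_pi, Set.mem_univ, forall_const, not_forall] at hz
      obtain ⟨i, hi⟩ := hz
      exact (Finset.prod_eq_zero (Finset.mem_univ i) (Set.indicator_of_notMem hi _)).symm
  rw [this, lintegral_pi_prod μ _ fun i => (hr i).indicator (hs i)]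
  refine Finset.prod_congr rfl fun i _ => ?_
  rw [withDensity_apply _ (hs i), lintegral_indicator (hs i)]

lemma gaussianReal_shift_eq_withDensity (a : ℝ) :
    gaussianReal a 1 =
      (gaussianReal 0 1).withDensity fun z => ENNReal.ofReal (Real.exp (a * z - a ^ 2 / 2)) := by
  rw [gaussianReal_of_var_ne_zero _ one_ne_zero, gaussianReal_of_var_ne_zero _ one_ne_zero,
    ← withDensity_mul _ (measurable_gaussianPDF _ _) (by fun_prop)]
  congr 1
  funext z
  simp only [Pi.mul_apply, gaussianPDF, gaussianPDFReal]
  rw [← ENNReal.ofReal_mul (by positivity), mul_assoc _ (Real.exp _), ← Real.exp_add]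
  congr 3
  simp only [NNReal.coe_one]
  ring

/-- The Cameron–Martin formula: tilting a standard Gaussian vector by `exp ⟨a, z⟩` translates it
by `a`. -/
lemma lintegral_gaussian_mul_exp {ι : Type*} [Fintype ι] (a : ι → ℝ) (f : (ι → ℝ) → ℝ≥0∞)
    (hf : Measurable f) :
    ∫⁻ z, f z * ENNReal.ofReal (Real.exp (a ⬝ᵥ z)) ∂(Measure.pi fun _ : ι => gaussianReal 0 1) =
      ENNReal.ofReal (Real.exp (a ⬝ᵥ a / 2)) *
        ∫⁻ z, f (z + a) ∂(Measure.pi fun _ : ι => gaussianReal 0 1) := by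
  have hmp : MeasurePreserving (fun (z : ι → ℝ) => z + a)
      (Measure.pi fun _ : ι => gaussianReal 0 1) (Measure.pi fun i : ι => gaussianReal (a i) 1) :=
    measurePreserving_pi (fun _ : ι => gaussianReal 0 1) (fun i : ι => gaussianReal (a i) 1)
      (f := fun i x => x + a i) fun i =>
        ⟨by fun_prop, by rw [gaussianReal_map_add_const, zero_add]⟩
  rw [hmp.lintegral_comp hf]
  have h1 : ∀ i, IsProbabilityMeasure ((gaussianReal 0 1).withDensity
      fun z => ENNReal.ofReal (Real.exp (a i * z - a i ^ 2 / 2))) := fun i => by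
    rw [← gaussianReal_shift_eq_withDensity]; infer_instance
  rw [show (fun i => gaussianReal (a i) 1) = fun i => (gaussianReal 0 1).withDensity
      fun z => ENNReal.ofReal (Real.exp (a i * z - a i ^ 2 / 2)) from
    funext fun i => gaussianReal_shift_eq_withDensity (a i)]
  rw [pi_withDensity _ _ fun i => by fun_prop,
    lintegral_withDensity_eq_lintegral_mul _ (by fun_prop) hf,
    ← lintegral_const_mul _ (by fun_prop)]
  refine lintegral_congr fun z => ?_
  simp only [Pi.mul_apply]
  rw [← ENNReal.ofReal_prod_of_nonneg fun i _ => (Real.exp_pos _).le, ← Real.exp_sum, ← mul_assoc,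
    ← ENNReal.ofReal_mul (Real.exp_pos _).le, ← Real.exp_add, mul_comm]
  congr 3
  simp only [dotProduct, Finset.sum_sub_distrib, Finset.sum_div]
  simp only [sq]
  ring

/-- A matrix with orthonormal rows maps a standard Gaussian vector to a standard Gaussian
vector. -/
lemma measurePreserving_gaussian_mulVec {ι κ : Type*} [Fintype ι] [Fintype κ] [DecidableEq ι]
    [DecidableEq κ] (W : Matrix κ ι ℝ) (hW : W * Wᵀ = 1) :
    MeasurePreserving (fun z : ι → ℝ => W *ᵥ z) (Measure.pi fun _ : ι => gaussianReal 0 1)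
      (Measure.pi fun _ : κ => gaussianReal 0 1) := by
  let T : (ι → ℝ) →L[ℝ] (κ → ℝ) := LinearMap.toContinuousLinearMap W.mulVecLin
  have hT : (fun z : ι → ℝ => W *ᵥ z) = T := rfl
  refine ⟨by rw [hT]; fun_prop, ?_⟩
  rw [hT]
  -- it suffices to compare characteristic functions
  have h1 : ∀ L : StrongDual ℝ ℝ, charFunDual (gaussianReal 0 1) L =
      Complex.exp (-((L 1 ^ 2 : ℝ) : ℂ) / 2) := by
    intro L
    have : charFunDual (gaussianReal 0 1) L = charFun (gaussianReal 0 1) (L 1) := by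
      rw [charFunDual_apply, charFun_apply_real]
      refine integral_congr_ae (Filter.Eventually.of_forall fun x => ?_)
      have hx : L x = L 1 * x := by
        conv_lhs => rw [show x = x • (1 : ℝ) by simp, map_smul]
        simp [mul_comm]
      simp [hx]
    rw [this, charFun_gaussianReal]
    congr 1
    push_cast
    ring
  apply Measure.ext_of_charFunDual
  ext L
  rw [charFunDual_map, charFunDual_pi, charFunDual_pi]
  simp_rw [h1]
  rw [← Complex.exp_sum, ← Complex.exp_sum, ← Finset.sum_div, ← Finset.sum_div,
    Finset.sum_neg_distrib, Finset.sum_neg_distrib]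
  congr 3
  norm_cast
  -- both sums are `‖Wᵀ l‖² = ‖l‖²` for the coefficient vector `l` of `L`
  let l : κ → ℝ := fun i => L (Pi.single i 1)
  have hL : ∀ v : κ → ℝ, L v = l ⬝ᵥ v := by
    intro v
    conv_lhs => rw [← Finset.univ_sum_single v, map_sum]
    refine Finset.sum_congr rfl fun i _ => ?_
    rw [show (Pi.single i (v i) : κ → ℝ) = v i • Pi.single i 1 by
      rw [← Pi.single_smul, smul_eq_mul, mul_one], map_smul, smul_eq_mul, mul_comm]
  have e1 : ∀ k, ((L.comp T).comp (.single ℝ (fun _ : ι => ℝ) k)) 1 = (Wᵀ *ᵥ l) k := by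
    intro k
    change L (W *ᵥ Pi.single k 1) = _
    rw [hL, Matrix.mulVec_single_one, Matrix.mulVec, dotProduct_comm]
    rfl
  have e2 : ∀ i, (L.comp (.single ℝ (fun _ : κ => ℝ) i)) 1 = l i := fun i => rfl
  simp_rw [e1, e2]
  calc ∑ k, (Wᵀ *ᵥ l) k ^ 2 = (Wᵀ *ᵥ l) ⬝ᵥ (Wᵀ *ᵥ l) := by
        simp [dotProduct, sq]
    _ = l ⬝ᵥ (W * Wᵀ) *ᵥ l := by
        rw [← Matrix.mulVec_mulVec, Matrix.dotProduct_mulVec l, ← Matrix.mulVec_transpose]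
    _ = ∑ i, l i ^ 2 := by simp [hW, dotProduct, sq]

/-- The ratio of the densities of `N(0, 1)` and `N(0, 1/μ)`. -/
noncomputable def gaussianRatio (μ z : ℝ) : ℝ≥0∞ :=
  ENNReal.ofReal (Real.sqrt μ⁻¹ * Real.exp ((μ - 1) * z ^ 2 / 2))

lemma measurable_gaussianRatio (μ : ℝ) : Measurable (gaussianRatio μ) := by
  unfold gaussianRatio; fun_prop

lemma gaussianReal_eq_withDensity_ratio {μ : ℝ≥0} (hμ : 0 < μ) :
    gaussianReal 0 1 = (gaussianReal 0 μ⁻¹).withDensity (gaussianRatio μ) := by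
  have hμ' : (0 : ℝ) < μ := hμ
  rw [gaussianReal_of_var_ne_zero _ one_ne_zero, gaussianReal_of_var_ne_zero _ (by positivity),
    ← withDensity_mul _ (measurable_gaussianPDF _ _) (measurable_gaussianRatio _)]
  congr 1
  funext z
  simp only [Pi.mul_apply, gaussianPDF, gaussianPDFReal, gaussianRatio]
  rw [← ENNReal.ofReal_mul (by positivity), mul_mul_mul_comm, ← Real.exp_add]
  congr 2
  · simp only [NNReal.coe_one, NNReal.coe_inv, mul_one]
    rw [Real.sqrt_mul (by positivity) (μ : ℝ)⁻¹]
    field_simp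
  · congr 1
    simp only [NNReal.coe_one, NNReal.coe_inv]
    field_simp
    ring

/-- The integrand is a multiple of the density of `N(0, 1/(2 - μ))`. -/
lemma lintegral_gaussianRatio_sq {μ : ℝ≥0} (hμ : 0 < μ) (hμ2 : μ < 2) :
    ∫⁻ z, gaussianRatio μ z ^ 2 ∂(gaussianReal 0 μ⁻¹) =
      ENNReal.ofReal (Real.sqrt (μ * (2 - μ)))⁻¹ := by
  have hμ' : (0 : ℝ) < μ := hμ
  have hμ2' : (μ : ℝ) < 2 := hμ2
  have h2 : (0 : ℝ) < 2 - μ := by linarith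
  let v : ℝ≥0 := ⟨(2 - (μ : ℝ))⁻¹, by positivity⟩
  have hv : v ≠ 0 := by
    intro h
    have : (v : ℝ) = 0 := by rw [h]; rfl
    exact (inv_pos.2 h2).ne' this
  rw [gaussianReal_of_var_ne_zero _ (by positivity), lintegral_withDensity_eq_lintegral_mul _
    (measurable_gaussianPDF _ _) ((measurable_gaussianRatio _).pow_const 2)]
  rw [← mul_one (ENNReal.ofReal _), ← lintegral_gaussianPDF_eq_one 0 hv,
    ← lintegral_const_mul _ (measurable_gaussianPDF _ _)]
  refine lintegral_congr fun z => ?_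
  simp only [Pi.mul_apply, gaussianPDF, gaussianPDFReal, gaussianRatio]
  rw [← ENNReal.ofReal_pow (by positivity), ← ENNReal.ofReal_mul (by positivity),
    ← ENNReal.ofReal_mul (by positivity)]
  congr 1
  have e1 : (Real.sqrt (μ : ℝ)⁻¹ * Real.exp (((μ : ℝ) - 1) * z ^ 2 / 2)) ^ 2 =
      (μ : ℝ)⁻¹ * Real.exp (((μ : ℝ) - 1) * z ^ 2) := by
    rw [mul_pow, Real.sq_sqrt (by positivity), ← Real.exp_nat_mul]
    congr 2
    push_cast
    ring
  have hvc : (v : ℝ) = (2 - (μ : ℝ))⁻¹ := rfl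
  rw [e1, hvc, mul_mul_mul_comm, ← Real.exp_add, ← mul_assoc]
  congr 1
  · simp only [NNReal.coe_inv]
    rw [Real.sqrt_mul (by positivity) (μ : ℝ)⁻¹, Real.sqrt_mul (by positivity) (2 - (μ : ℝ))⁻¹,
      Real.sqrt_mul hμ'.le, Real.sqrt_inv, Real.sqrt_inv]
    have h3 := Real.sq_sqrt hμ'.le
    have h4 := Real.sqrt_pos.2 hμ'
    have h5 := Real.sqrt_pos.2 h2
    field_simp
    exact h3
  · congr 1
    simp only [NNReal.coe_inv]
    field_simp
    ring

/-- Change of the variances of a Gaussian vector: a Cauchy–Schwarz bound in which the constant is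
the second moment of the density ratio. -/
lemma lintegral_gaussian_sq_le {ι : Type*} [Fintype ι] (μ : ι → ℝ≥0) (hμ : ∀ k, 0 < μ k)
    (hμ2 : ∀ k, μ k < 2) (a : ι → ℝ) (ha : ∀ k, a k ^ 2 = (μ k : ℝ)⁻¹)
    (f : (ι → ℝ) → ℝ≥0∞) (hf : Measurable f) :
    (∫⁻ z, f z ∂(Measure.pi fun _ : ι => gaussianReal 0 1)) ^ 2 ≤
      ENNReal.ofReal (∏ k, (Real.sqrt (μ k * (2 - μ k)))⁻¹) *
        ∫⁻ z, f (fun k => a k * z k) ^ 2 ∂(Measure.pi fun _ : ι => gaussianReal 0 1) := by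
  have hmp : MeasurePreserving (fun (z : ι → ℝ) k => a k * z k)
      (Measure.pi fun _ : ι => gaussianReal 0 1) (Measure.pi fun k : ι => gaussianReal 0 (μ k)⁻¹) :=
    measurePreserving_pi (fun _ : ι => gaussianReal 0 1) (fun k : ι => gaussianReal 0 (μ k)⁻¹)
      (f := fun k x => a k * x) fun k =>
        ⟨by fun_prop, by
          rw [gaussianReal_map_const_mul, mul_zero, mul_one]
          congr 1
          ext
          exact ha k⟩
  rw [hmp.lintegral_comp (hf.pow_const 2)]
  have h1 : ∀ k, IsProbabilityMeasure ((gaussianReal 0 (μ k)⁻¹).withDensity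
      (gaussianRatio (μ k))) := fun k => by
    rw [← gaussianReal_eq_withDensity_ratio (hμ k)]; infer_instance
  have hr : Measurable fun z : ι → ℝ => ∏ k, gaussianRatio (μ k) (z k) :=
    Finset.measurable_prod _ fun k _ => (measurable_gaussianRatio _).comp (measurable_pi_apply k)
  rw [show (fun _ : ι => gaussianReal 0 1) = fun k => (gaussianReal 0 (μ k)⁻¹).withDensity
      (gaussianRatio (μ k)) from funext fun k => gaussianReal_eq_withDensity_ratio (hμ k),
    pi_withDensity _ _ fun k => measurable_gaussianRatio _,
    lintegral_withDensity_eq_lintegral_mul _ hr hf]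
  have hcs := ENNReal.lintegral_mul_le_Lp_mul_Lq
    (Measure.pi fun k : ι => gaussianReal 0 (μ k)⁻¹) Real.HolderConjugate.two_two
    hr.aemeasurable hf.aemeasurable
  refine (pow_le_pow_left₀ (by simp) hcs 2).trans (le_of_eq ?_)
  rw [mul_pow, ← ENNReal.rpow_mul_natCast, ← ENNReal.rpow_mul_natCast]
  rw [show (1 / 2 : ℝ) * (2 : ℕ) = 1 by norm_num, ENNReal.rpow_one, ENNReal.rpow_one]
  simp_rw [ENNReal.rpow_two, ← Finset.prod_pow]
  congr 1
  rw [lintegral_pi_prod _ (fun k x => gaussianRatio (μ k) x ^ 2)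
    fun k => (measurable_gaussianRatio _).pow_const 2]
  rw [ENNReal.ofReal_prod_of_nonneg fun k _ => by positivity]
  exact Finset.prod_congr rfl fun k _ => lintegral_gaussianRatio_sq (hμ k) (hμ2 k)

/-! ### Decorrelation of nearly orthonormal measurements -/

/-- A diagonally dominant matrix is invertible with an inverse of `ℓ¹` norm at most `2`. -/
lemma sum_abs_le_two_mul_of_dominant {κ : Type*} [Fintype κ] [DecidableEq κ] (G : Matrix κ κ ℝ)
    (hdiag : ∀ i, G i i = 1)
    (hoff : ∀ i k, i ≠ k → |G i k| ≤ 1 / (2 * Fintype.card κ)) (v : κ → ℝ) :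
    ∑ i, |v i| ≤ 2 * ∑ i, |(G *ᵥ v) i| := by
  rcases isEmpty_or_nonempty κ with hκ | hκ
  · simp
  have hm : (0 : ℝ) < Fintype.card κ := by exact_mod_cast Fintype.card_pos
  have h : ∀ i, |v i| ≤ |(G *ᵥ v) i| + 1 / (2 * Fintype.card κ) * ∑ k, |v k| := by
    intro i
    have e : v i = (G *ᵥ v) i - ∑ k ∈ Finset.univ.erase i, G i k * v k := by
      rw [Matrix.mulVec, dotProduct, ← Finset.add_sum_erase _ _ (Finset.mem_univ i), hdiag]
      ring
    have e2 : |∑ k ∈ Finset.univ.erase i, G i k * v k| ≤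
        1 / (2 * Fintype.card κ) * ∑ k, |v k| := by
      refine (Finset.abs_sum_le_sum_abs _ _).trans ?_
      rw [Finset.mul_sum]
      refine (Finset.sum_le_sum fun k hk => ?_).trans
        (Finset.sum_le_sum_of_subset_of_nonneg (Finset.erase_subset i _) fun k _ _ => by positivity)
      rw [abs_mul]
      exact mul_le_mul_of_nonneg_right (hoff i k (Finset.ne_of_mem_erase hk).symm) (abs_nonneg _)
    calc |v i| = |(G *ᵥ v) i - ∑ k ∈ Finset.univ.erase i, G i k * v k| := by rw [← e]
      _ ≤ _ := (abs_sub _ _).trans (by gcongr)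
  have h2 := Finset.sum_le_sum fun i (_ : i ∈ Finset.univ) => h i
  rw [Finset.sum_add_distrib, Finset.sum_const, Finset.card_univ, nsmul_eq_mul, ← mul_assoc,
    show (Fintype.card κ : ℝ) * (1 / (2 * Fintype.card κ)) = 1 / 2 by field_simp] at h2
  linarith

lemma det_ne_zero_of_dominant {κ : Type*} [Fintype κ] [DecidableEq κ] (G : Matrix κ κ ℝ)
    (hdiag : ∀ i, G i i = 1)
    (hoff : ∀ i k, i ≠ k → |G i k| ≤ 1 / (2 * Fintype.card κ)) : G.det ≠ 0 := by
  intro h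
  obtain ⟨v, hv, hGv⟩ := Matrix.exists_mulVec_eq_zero_iff.2 h
  have h1 := sum_abs_le_two_mul_of_dominant G hdiag hoff v
  rw [hGv] at h1
  simp only [Pi.zero_apply, abs_zero, Finset.sum_const_zero, mul_zero] at h1
  refine hv (funext fun i => ?_)
  have := Finset.single_le_sum (fun i _ => abs_nonneg (v i)) (Finset.mem_univ i)
  exact abs_nonpos_iff.1 (this.trans h1)

/-- The eigenvalues of `Uᵀ U`, with the eigenvalue `0` replaced by `1`, have total squared distance
to `1` at most `1 / 4`: this is a bound for `‖U Uᵀ - 1‖` in the Frobenius norm. -/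
lemma sum_sq_eigenvalues_sub_one_le {ι κ : Type*} [Fintype ι] [Fintype κ] [DecidableEq ι]
    [DecidableEq κ] (U : Matrix κ ι ℝ) (hdiag : ∀ i, (U * Uᵀ) i i = 1)
    (hoff : ∀ i k, i ≠ k → |(U * Uᵀ) i k| ≤ 1 / (2 * Fintype.card κ))
    (hH : (Uᵀ * U).IsHermitian) :
    ∑ k, ((if hH.eigenvalues k = 0 then 1 else hH.eigenvalues k) - 1) ^ 2 ≤ 1 / 4 := by
  set μ := hH.eigenvalues with hμ
  -- expand the square and use that the rank of `Uᵀ U` is at most the number of rows of `U`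
  have hsplit : ∀ k, ((if μ k = 0 then 1 else μ k) - 1) ^ 2 =
      μ k ^ 2 - 2 * μ k + if μ k ≠ 0 then 1 else 0 := by
    intro k
    by_cases h : μ k = 0
    · simp [h]
    · simp only [h, if_false, ne_eq, not_false_eq_true, if_true]; ring
  have hrank : ∑ k, (if μ k ≠ 0 then (1 : ℝ) else 0) ≤ Fintype.card κ := by
    rw [Finset.sum_boole, ← Fintype.card_subtype]
    have := hH.rank_eq_card_non_zero_eigs
    rw [Matrix.rank_transpose_mul_self] at this
    rw [← this]
    exact_mod_cast U.rank_le_card_height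
  have htr : ∑ k, μ k = Fintype.card κ := by
    have h1 := hH.trace_eq_sum_eigenvalues
    rw [Matrix.trace_mul_comm] at h1
    simp only [RCLike.ofReal_real_eq_id, id_eq] at h1
    rw [← h1, Matrix.trace]
    simp [hdiag]
  have htr2 : ∑ k, μ k ^ 2 = ∑ i, ∑ k, (U * Uᵀ) i k ^ 2 := by
    have h1 : (Uᵀ * U * (Uᵀ * U)).trace = ∑ k, μ k ^ 2 := by
      have h2 := hH.spectral_theorem
      rw [h2, ← map_mul, Unitary.conjStarAlgAut_apply, Matrix.trace_mul_comm, ← mul_assoc,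
        Unitary.coe_star_mul_self, one_mul, Matrix.diagonal_mul_diagonal, Matrix.trace_diagonal]
      simp [sq, hμ]
    rw [← h1, show Uᵀ * U * (Uᵀ * U) = Uᵀ * (U * Uᵀ * U) by simp only [Matrix.mul_assoc],
      Matrix.trace_mul_comm, Matrix.mul_assoc (U * Uᵀ)]
    simp only [Matrix.trace, Matrix.diag_apply]
    refine Finset.sum_congr rfl fun i _ => ?_
    rw [Matrix.mul_apply]
    refine Finset.sum_congr rfl fun k _ => ?_
    rw [sq]
    congr 1
    rw [← Matrix.transpose_apply (U * Uᵀ), Matrix.transpose_mul, Matrix.transpose_transpose]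
  have hoff2 : ∑ i, ∑ k, (U * Uᵀ) i k ^ 2 ≤ Fintype.card κ + 1 / 4 := by
    rcases isEmpty_or_nonempty κ with hκ | hκ
    · simp
    have hm : (0 : ℝ) < Fintype.card κ := by exact_mod_cast Fintype.card_pos
    have h1 : ∀ i, ∑ k, (U * Uᵀ) i k ^ 2 ≤
        1 + Fintype.card κ * (1 / (2 * Fintype.card κ)) ^ 2 := by
      intro i
      rw [← Finset.add_sum_erase _ _ (Finset.mem_univ i), hdiag, one_pow]
      gcongr
      refine (Finset.sum_le_card_nsmul _ _ ((1 / (2 * Fintype.card κ : ℝ)) ^ 2)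
        fun k hk => ?_).trans ?_
      · rw [← sq_abs]
        exact pow_le_pow_left₀ (abs_nonneg _) (hoff i k (Finset.ne_of_mem_erase hk).symm) 2
      · rw [nsmul_eq_mul]
        gcongr
        exact Finset.card_le_univ _
    refine (Finset.sum_le_sum fun i _ => h1 i).trans (le_of_eq ?_)
    rw [Finset.sum_const, Finset.card_univ, nsmul_eq_mul]
    field_simp
    ring
  simp_rw [hsplit]
  rw [Finset.sum_add_distrib, Finset.sum_sub_distrib, ← Finset.mul_sum, htr, htr2]
  linarith

/-- With `ν (2 - ν) = 1 - (ν - 1) ^ 2` the bound is Weierstrass' inequality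
`∏ (1 - a k) ≥ 1 - ∑ a k`. -/
lemma prod_inv_sqrt_le_two {ι : Type*} [Fintype ι] (ν : ι → ℝ)
    (h : ∑ k, (ν k - 1) ^ 2 ≤ 1 / 4) : ∏ k, (Real.sqrt (ν k * (2 - ν k)))⁻¹ ≤ 2 := by
  have h0 : ∀ k, (ν k - 1) ^ 2 ≤ 1 / 4 := fun k =>
    (Finset.single_le_sum (fun i _ => sq_nonneg (ν i - 1)) (Finset.mem_univ k)).trans h
  have h1 : ∀ s : Finset ι, 1 - ∑ k ∈ s, (ν k - 1) ^ 2 ≤ ∏ k ∈ s, (ν k * (2 - ν k)) := by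
    classical
    intro s
    have hs : ∑ k ∈ s, (ν k - 1) ^ 2 ≤ 1 / 4 :=
      (Finset.sum_le_univ_sum_of_nonneg fun k => sq_nonneg _).trans h
    clear hs
    induction s using Finset.induction_on with
    | empty => simp
    | insert a s ha ih =>
      rw [Finset.sum_insert ha, Finset.prod_insert ha]
      have h3 : ∏ k ∈ s, (ν k * (2 - ν k)) ≤ 1 :=
        Finset.prod_le_one (fun k _ => by nlinarith [h0 k])
          fun k _ => by nlinarith [sq_nonneg (ν k - 1)]
      nlinarith [sq_nonneg (ν a - 1), h0 a]
  have h2 := h1 Finset.univ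
  have h3 : ∏ k, (Real.sqrt (ν k * (2 - ν k)))⁻¹ = (Real.sqrt (∏ k, (ν k * (2 - ν k))))⁻¹ := by
    rw [Finset.prod_inv_distrib, Real.sqrt_prod]
    exact fun k _ => by nlinarith [h0 k]
  rw [h3, show (2 : ℝ) = (1 / 2)⁻¹ by norm_num]
  refine inv_anti₀ (by norm_num) (Real.le_sqrt_of_sq_le ?_)
  norm_num at h2 ⊢
  linarith

/-- If the Gram matrix of the rows of `U` is close to the identity, there is a linear map `A` under
which the Gaussian vector `U A z` has independent standard coordinates, while the law of `A z`
controls the standard Gaussian law up to a constant and a square root. -/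
lemma exists_decorrelation {ι κ : Type*} [Fintype ι] [Fintype κ] [DecidableEq ι] [DecidableEq κ]
    (U : Matrix κ ι ℝ) (hdiag : ∀ i, (U * Uᵀ) i i = 1)
    (hoff : ∀ i k, i ≠ k → |(U * Uᵀ) i k| ≤ 1 / (2 * Fintype.card κ)) :
    ∃ A : Matrix ι ι ℝ, (U * A) * (U * A)ᵀ = 1 ∧
      (∀ v, ∑ i, |((U * A) *ᵥ (Aᵀ *ᵥ v)) i| ≤ 2 * ∑ i, |(U *ᵥ v) i|) ∧
      (∀ v, (Aᵀ *ᵥ v) ⬝ᵥ (Aᵀ *ᵥ v) ≤ 2 * (v ⬝ᵥ v)) ∧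
      ∀ f : (ι → ℝ) → ℝ≥0∞, Measurable f →
        (∫⁻ z, f z ∂(Measure.pi fun _ : ι => gaussianReal 0 1)) ^ 2 ≤
          2 * ∫⁻ z, f (A *ᵥ z) ^ 2 ∂(Measure.pi fun _ : ι => gaussianReal 0 1) := by
  have hH : (Uᵀ * U).IsHermitian := by
    have := Matrix.isHermitian_conjTranspose_mul_self U
    rwa [Matrix.conjTranspose_eq_transpose_of_trivial] at this
  set μ := hH.eigenvalues with hμ
  set ν : ι → ℝ := fun k => if μ k = 0 then 1 else μ k with hν
  have hsum : ∑ k, (ν k - 1) ^ 2 ≤ 1 / 4 := sum_sq_eigenvalues_sub_one_le U hdiag hoff hH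
  have h0 : ∀ k, (ν k - 1) ^ 2 ≤ 1 / 4 := fun k =>
    (Finset.single_le_sum (fun i _ => sq_nonneg (ν i - 1)) (Finset.mem_univ k)).trans hsum
  have hlo : ∀ k, 1 / 2 ≤ ν k := fun k => by nlinarith [h0 k]
  have hhi : ∀ k, ν k < 2 := fun k => by nlinarith [h0 k]
  set O : Matrix ι ι ℝ := (hH.eigenvectorUnitary : Matrix ι ι ℝ) with hO
  have hO1 : Oᵀ * O = 1 := by
    have := Unitary.coe_star_mul_self hH.eigenvectorUnitary
    rwa [Matrix.star_eq_conjTranspose, Matrix.conjTranspose_eq_transpose_of_trivial] at this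
  have hO2 : O * Oᵀ = 1 := mul_eq_one_comm.1 hO1
  have hspec : Uᵀ * U = O * Matrix.diagonal μ * Oᵀ := by
    have := hH.spectral_theorem
    rw [Unitary.conjStarAlgAut_apply, Matrix.star_eq_conjTranspose,
      Matrix.conjTranspose_eq_transpose_of_trivial] at this
    exact this
  set a : ι → ℝ := fun k => (Real.sqrt (ν k))⁻¹ with ha
  have ha2 : ∀ k, a k ^ 2 = (ν k)⁻¹ := fun k => by
    rw [ha, inv_pow, Real.sq_sqrt (by linarith [hlo k])]
  set A : Matrix ι ι ℝ := O * Matrix.diagonal a with hA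
  have hAT : Aᵀ = Matrix.diagonal a * Oᵀ := by
    rw [hA, Matrix.transpose_mul, Matrix.diagonal_transpose]
  -- `p` is the indicator of the non-zero eigenvalues; `O diag(p) Oᵀ` is the projection onto the
  -- row space of `U`
  set p : ι → ℝ := fun k => if μ k = 0 then 0 else 1 with hp
  have hap : ∀ k, a k * a k * μ k = p k := fun k => by
    rw [← sq, ha2]
    by_cases h : μ k = 0
    · simp [hp, h]
    · simp [hp, hν, h]
  have hAA : A * Aᵀ = O * Matrix.diagonal (fun k => a k * a k) * Oᵀ := by
    rw [hAT, hA, ← Matrix.diagonal_mul_diagonal]; simp only [Matrix.mul_assoc]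
  have hconj : ∀ d e : ι → ℝ, (O * Matrix.diagonal d * Oᵀ) * (O * Matrix.diagonal e * Oᵀ) =
      O * Matrix.diagonal (fun k => d k * e k) * Oᵀ := by
    intro d e
    rw [← Matrix.diagonal_mul_diagonal]
    calc _ = O * Matrix.diagonal d * (Oᵀ * O) * Matrix.diagonal e * Oᵀ := by
          simp only [Matrix.mul_assoc]
      _ = _ := by rw [hO1, Matrix.mul_one]; simp only [Matrix.mul_assoc]
  have hAH : A * Aᵀ * (Uᵀ * U) = O * Matrix.diagonal p * Oᵀ := by
    rw [hAA, hspec, hconj]; simp_rw [hap]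
  have hHA : Uᵀ * U * (A * Aᵀ) = O * Matrix.diagonal p * Oᵀ := by
    rw [hAA, hspec, hconj]
    simp_rw [mul_comm (μ _), hap]
  have hUP : U * (O * Matrix.diagonal p * Oᵀ) = U := by
    set R := 1 - O * Matrix.diagonal p * Oᵀ with hR
    have hHR : Uᵀ * U * R = 0 := by
      rw [hR, mul_sub, mul_one, hspec, hconj, sub_eq_zero]
      congr 3
      funext k
      by_cases h : μ k = 0
      · simp [h]
      · simp [hp, h]
    have hUR : U * R = 0 := by
      rw [← Matrix.conjTranspose_mul_self_eq_zero, Matrix.conjTranspose_eq_transpose_of_trivial,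
        Matrix.transpose_mul, Matrix.mul_assoc, ← Matrix.mul_assoc Uᵀ, hHR, Matrix.mul_zero]
    rw [hR, Matrix.mul_sub, Matrix.mul_one, sub_eq_zero] at hUR
    exact hUR.symm
  refine ⟨A, ?_, ?_, ?_, ?_⟩
  · have hdet : IsUnit (U * Uᵀ).det := (det_ne_zero_of_dominant _ hdiag hoff).isUnit
    have h1 : (U * A) * (U * A)ᵀ * (U * Uᵀ) = 1 * (U * Uᵀ) := by
      calc (U * A) * (U * A)ᵀ * (U * Uᵀ) = U * (A * Aᵀ * (Uᵀ * U)) * Uᵀ := by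
            rw [Matrix.transpose_mul]; simp only [Matrix.mul_assoc]
        _ = 1 * (U * Uᵀ) := by rw [hAH, hUP, Matrix.one_mul]
    exact ((Matrix.isUnit_iff_isUnit_det _).2 hdet).mul_right_cancel h1
  · intro v
    have h := sum_abs_le_two_mul_of_dominant _ hdiag hoff ((U * A) *ᵥ (Aᵀ *ᵥ v))
    have e : (U * Uᵀ) *ᵥ ((U * A) *ᵥ (Aᵀ *ᵥ v)) = U *ᵥ v := by
      rw [Matrix.mulVec_mulVec, Matrix.mulVec_mulVec]
      congr 1
      calc U * Uᵀ * (U * A) * Aᵀ = U * (Uᵀ * U * (A * Aᵀ)) := by simp only [Matrix.mul_assoc]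
        _ = U := by rw [hHA, hUP]
    rwa [e] at h
  · intro v
    have e1 : (Oᵀ *ᵥ v) ⬝ᵥ (Oᵀ *ᵥ v) = v ⬝ᵥ v := by
      rw [Matrix.dotProduct_mulVec, Matrix.vecMul_transpose, Matrix.mulVec_mulVec, hO2,
        Matrix.one_mulVec]
    rw [← e1, hAT, ← Matrix.mulVec_mulVec]
    simp only [dotProduct, Matrix.mulVec_diagonal, Finset.mul_sum]
    refine Finset.sum_le_sum fun k _ => ?_
    have h2 : a k ^ 2 ≤ 2 := by
      rw [ha2, show (2 : ℝ) = (1 / 2)⁻¹ by norm_num]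
      exact inv_anti₀ (by norm_num) (hlo k)
    nlinarith [sq_nonneg ((Oᵀ *ᵥ v) k)]
  · intro f hf
    have hrot := measurePreserving_gaussian_mulVec O hO2
    rw [← hrot.lintegral_comp hf]
    let νn : ι → ℝ≥0 := fun k => ⟨ν k, by linarith [hlo k]⟩
    have h := lintegral_gaussian_sq_le νn
      (fun k => show (0 : ℝ) < ν k by linarith [hlo k])
      (fun k => show ν k < (2 : ℝ) from hhi k)
      a ha2 _ (hf.comp hrot.measurable)
    refine h.trans ?_
    have hA' : ∀ z : ι → ℝ, O *ᵥ (fun k => a k * z k) = A *ᵥ z := fun z => by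
      rw [hA, ← Matrix.mulVec_mulVec]
      congr 1
      funext k
      rw [Matrix.mulVec_diagonal]
    simp only [Function.comp_apply, hA']
    gcongr
    rw [← ENNReal.ofReal_ofNat 2]
    exact ENNReal.ofReal_le_ofReal (prod_inv_sqrt_le_two ν hsum)

/-! ### Rademacher martingale transforms and chaoses -/

lemma isProbabilityMeasure_signLaw {p : ℝ} (h0 : 0 ≤ p) (h1 : p ≤ 1) :
    IsProbabilityMeasure (signLaw p) := by
  refine ⟨?_⟩
  simp only [signLaw, Measure.coe_add, Measure.coe_smul, Pi.add_apply, Pi.smul_apply, measure_univ,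
    smul_eq_mul, mul_one]
  rw [← ENNReal.ofReal_add h0 (by linarith)]
  simp

lemma ae_signLaw (p : ℝ) : ∀ᵐ x ∂(signLaw p), x = 1 ∨ x = -1 := by
  have hm : MeasurableSet {x : ℝ | ¬(x = 1 ∨ x = -1)} := by measurability
  rw [ae_iff, signLaw]
  simp only [Measure.coe_add, Measure.coe_smul, Pi.add_apply, Pi.smul_apply, smul_eq_mul]
  rw [Measure.dirac_apply' _ hm, Measure.dirac_apply' _ hm]
  simp

instance : IsProbabilityMeasure rademacher :=
  isProbabilityMeasure_signLaw (by norm_num) (by norm_num)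

lemma measurePreserving_neg_rademacher :
    MeasurePreserving (fun x : ℝ => -x) rademacher rademacher := by
  refine ⟨measurable_neg, ?_⟩
  rw [rademacher, signLaw, Measure.map_add _ _ measurable_neg, Measure.map_smul, Measure.map_smul,
    Measure.map_dirac' measurable_neg, Measure.map_dirac' measurable_neg, neg_neg, add_comm]
  norm_num

lemma ae_pi_rademacher (ι : Type*) [Fintype ι] :
    ∀ᵐ z ∂(Measure.pi fun _ : ι => rademacher), ∀ k, z k = 1 ∨ z k = -1 := by
  rw [ae_all_iff]
  intro k
  exact (Measure.quasiMeasurePreserving_eval (fun _ : ι => rademacher) k).ae (ae_signLaw _)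

lemma measurePreserving_flip {ι : Type*} [Fintype ι] [DecidableEq ι] (k : ι) :
    MeasurePreserving (fun z : ι → ℝ => Function.update z k (-z k))
      (Measure.pi fun _ : ι => rademacher) (Measure.pi fun _ : ι => rademacher) := by
  have h := measurePreserving_pi (fun _ : ι => rademacher) (fun _ : ι => rademacher)
    (f := fun i x => if i = k then -x else x) fun i => by
      by_cases hi : i = k
      · simpa [hi] using measurePreserving_neg_rademacher
      · simpa [hi, Function.id_def] using MeasurePreserving.id rademacher
  convert h using 2 with z
  funext i
  by_cases hi : i = k
  · subst hi; simp
  · simp [hi]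

lemma exp_add_exp_neg_le (y : ℝ) : Real.exp y + Real.exp (-y) ≤ 2 * Real.exp (y ^ 2 / 2) := by
  have := Real.cosh_le_exp_half_sq y
  rw [Real.cosh_eq] at this
  linarith

/-- A Rademacher martingale transform `∑ k, ξ k * B k`, where `B k` depends on the signs `ξ j` with
`j < k` only, is sub-Gaussian: conditionally on the smaller indices, the sign of largest index is
still uniform. -/
lemma lintegral_exp_rademacher_transform_le {ι : Type*} [Fintype ι] [LinearOrder ι]
    (B : ι → (ι → ℝ) → ℝ) (hB : ∀ k, Measurable (B k)) (β : ι → ℝ)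
    (hβ : ∀ᵐ z ∂(Measure.pi fun _ : ι => rademacher), ∀ k, |B k z| ≤ β k)
    (hflip : ∀ j k z, j ≤ k → B j (Function.update z k (-z k)) = B j z) (T : Finset ι) :
    ∫⁻ z, ENNReal.ofReal (Real.exp (∑ k ∈ T, z k * B k z)) ∂(Measure.pi fun _ : ι => rademacher) ≤
      ENNReal.ofReal (Real.exp ((∑ k ∈ T, β k ^ 2) / 2)) := by
  induction T using Finset.induction_on_max with
  | empty => simp
  | insert a s hs ih =>
    have ha : a ∉ s := fun h => (hs a h).ne rfl
    have hmeas : ∀ T : Finset ι, Measurable fun z : ι → ℝ => ∑ k ∈ T, z k * B k z :=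
      fun T => Finset.measurable_fun_sum _ fun k _ => (measurable_pi_apply k).mul (hB k)
    set Y : (ι → ℝ) → ℝ := fun z => ∑ k ∈ s, z k * B k z with hY
    have hYflip : ∀ z, Y (Function.update z a (-z a)) = Y z := fun z => by
      refine Finset.sum_congr rfl fun k hk => ?_
      rw [hflip k a z (hs k hk).le, Function.update_of_ne (hs k hk).ne]
    set F : (ι → ℝ) → ℝ≥0∞ := fun z => ENNReal.ofReal (Real.exp (z a * B a z + Y z)) with hF
    have hFm : Measurable F := by
      have h1 : Measurable Y := hmeas s
      have h2 := hB a
      fun_prop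
    -- average the integrand over the two values of the sign with the largest index `a`
    have h1 := (measurePreserving_flip a).lintegral_comp hFm
    have h2 : ∀ z : ι → ℝ, F (Function.update z a (-z a)) =
        ENNReal.ofReal (Real.exp (-(z a * B a z) + Y z)) := fun z => by
      simp only [hF, hYflip, hflip a a z le_rfl, Function.update_self]
      congr 3
      ring
    have h3 : ∀ᵐ z ∂(Measure.pi fun _ : ι => rademacher),
        F z + F (Function.update z a (-z a)) ≤
          2 * (ENNReal.ofReal (Real.exp (β a ^ 2 / 2)) * ENNReal.ofReal (Real.exp (Y z))) := by
      filter_upwards [hβ, ae_pi_rademacher ι] with z hz1 hz2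
      rw [h2, ← ENNReal.ofReal_add (by positivity) (by positivity),
        ← ENNReal.ofReal_mul (by positivity), ← ENNReal.ofReal_ofNat 2,
        ← ENNReal.ofReal_mul (by positivity)]
      refine ENNReal.ofReal_le_ofReal ?_
      rw [Real.exp_add, Real.exp_add, ← add_mul, ← mul_assoc]
      refine mul_le_mul_of_nonneg_right ((exp_add_exp_neg_le _).trans ?_) (Real.exp_pos _).le
      have : (z a * B a z) ^ 2 ≤ β a ^ 2 := by
        rw [mul_pow, show z a ^ 2 = 1 by rcases hz2 a with h | h <;> simp [h], one_mul, ← sq_abs]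
        exact pow_le_pow_left₀ (abs_nonneg _) (hz1 a) 2
      gcongr
    have h4 := lintegral_mono_ae h3
    rw [lintegral_add_left hFm, h1, ← two_mul,
      lintegral_const_mul _ (by have h1 : Measurable Y := hmeas s; fun_prop),
      lintegral_const_mul _ (by have h1 : Measurable Y := hmeas s; fun_prop)] at h4
    have h5 := (ENNReal.mul_le_mul_iff_right (by simp) (by simp)).1 h4
    simp only [Finset.sum_insert ha]
    refine h5.trans ?_
    rw [add_div, Real.exp_add, ENNReal.ofReal_mul (Real.exp_pos _).le]
    gcongr

/-- Chernoff's bound for a variable that is sub-Gaussian up to a constant. -/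
lemma measure_abs_ge_le_of_mgf {α : Type*} [MeasurableSpace α] (μ : Measure α) (X : α → ℝ)
    (hX : Measurable X) (K A r : ℝ) (hA : 0 < A) (hr : 0 ≤ r)
    (h : ∀ s : ℝ, ∫⁻ z, ENNReal.ofReal (Real.exp (s * X z)) ∂μ ≤
      ENNReal.ofReal (K * Real.exp (s ^ 2 * A / 2))) :
    μ {z | r ≤ |X z|} ≤ ENNReal.ofReal (2 * K * Real.exp (-(r ^ 2 / (2 * A)))) := by
  have one : ∀ e : ℝ, e ^ 2 = 1 →
      μ {z | r ≤ e * X z} ≤ ENNReal.ofReal (K * Real.exp (-(r ^ 2 / (2 * A)))) := by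
    intro e he
    -- Markov's inequality with the optimal exponent `r / A`
    have h1 : {z | r ≤ e * X z} ⊆
        {z | ENNReal.ofReal (Real.exp (r * r / A)) ≤
          ENNReal.ofReal (Real.exp (e * (r / A) * X z))} := by
      intro z hz
      refine ENNReal.ofReal_le_ofReal (Real.exp_le_exp.2 ?_)
      calc r * r / A = (r / A) * r := by ring
        _ ≤ (r / A) * (e * X z) := mul_le_mul_of_nonneg_left hz (by positivity)
        _ = _ := by ring
    have h2 := mul_meas_ge_le_lintegral (μ := μ)
      (f := fun z => ENNReal.ofReal (Real.exp (e * (r / A) * X z))) (by fun_prop)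
      (ENNReal.ofReal (Real.exp (r * r / A)))
    have h3 := (mul_le_mul_right (measure_mono (μ := μ) h1) _).trans (h2.trans (h (e * (r / A))))
    have h4 : μ {z | r ≤ e * X z} = ENNReal.ofReal (Real.exp (-(r * r / A))) *
        (ENNReal.ofReal (Real.exp (r * r / A)) * μ {z | r ≤ e * X z}) := by
      rw [← mul_assoc, ← ENNReal.ofReal_mul (Real.exp_pos _).le, ← Real.exp_add]
      simp
    rw [h4]
    refine (mul_le_mul_right h3 _).trans (le_of_eq ?_)
    rw [← ENNReal.ofReal_mul (Real.exp_pos _).le]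
    congr 1
    rw [mul_left_comm, ← Real.exp_add]
    congr 2
    rw [mul_pow, he]
    field_simp
    ring
  have hsub : {z | r ≤ |X z|} ⊆ {z | r ≤ 1 * X z} ∪ {z | r ≤ (-1) * X z} := by
    intro z hz
    rcases le_abs.1 (show r ≤ |X z| from hz) with h | h
    · left; simpa using h
    · right; simpa using h
  -- for negative `K` both sides are truncated to `0`
  have hK : 0 ≤ K * Real.exp (-(r ^ 2 / (2 * A))) ∨ K * Real.exp (-(r ^ 2 / (2 * A))) ≤ 0 :=
    le_total _ _
  refine (measure_mono hsub).trans ((measure_union_le _ _).trans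
    ((add_le_add (one 1 (by norm_num)) (one (-1) (by norm_num))).trans (le_of_eq ?_)))
  rcases hK with hK | hK
  · rw [← ENNReal.ofReal_add hK hK]; congr 1; ring
  · rw [ENNReal.ofReal_of_nonpos hK, ENNReal.ofReal_of_nonpos (by nlinarith), add_zero]

/-- Tail bound for the Rademacher chaos `∑ j, a j ξ_j ξ_{j+d}`. Each of the two parts `j < j + d`
and `j + d < j` is a Rademacher martingale transform. -/
lemma measure_shift_chaos_ge_le {n : ℕ} [NeZero n] (d : Fin n) (hd : d ≠ 0) (a : Fin n → ℝ)
    (A r : ℝ) (hA : 0 < A) (ha : ∑ j, a j ^ 2 ≤ A) (hr : 0 ≤ r) :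
    (Measure.pi fun _ : Fin n => rademacher) {z | r ≤ |∑ j, a j * (z j * z (j + d))|} ≤
      ENNReal.ofReal (4 * Real.exp (-(r ^ 2 / (8 * A)))) := by
  -- the general bound for a transform whose coefficients are `a ∘ e` times a single earlier sign
  have key : ∀ (e f : Fin n → Fin n), Function.Injective e →
      (Measure.pi fun _ : Fin n => rademacher)
        {z | r / 2 ≤ |∑ k, z k * (if f k < k then a (e k) * z (f k) else 0)|} ≤
      ENNReal.ofReal (2 * 1 * Real.exp (-((r / 2) ^ 2 / (2 * A)))) := by
    intro e f he
    refine measure_abs_ge_le_of_mgf _ _ ?_ 1 A (r / 2) hA (by linarith) fun s => ?_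
    · refine Finset.measurable_fun_sum _ fun k _ => ?_
      split_ifs <;> fun_prop
    · have h := lintegral_exp_rademacher_transform_le
        (fun k z => s * (if f k < k then a (e k) * z (f k) else 0))
        (fun k => by split_ifs <;> fun_prop) (fun k => |s * a (e k)|) ?_ ?_ Finset.univ
      · simp_rw [Finset.mul_sum]
        simp_rw [mul_left_comm s]
        refine h.trans ?_
        rw [one_mul]
        refine ENNReal.ofReal_le_ofReal (Real.exp_le_exp.2 ?_)
        simp_rw [sq_abs, mul_pow, ← Finset.mul_sum]
        have : ∑ k, a (e k) ^ 2 ≤ A := by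
          refine le_trans (le_of_eq ?_) ha
          exact (Equiv.ofBijective e (Finite.injective_iff_bijective.1 he)).sum_comp
            (fun k => a k ^ 2)
        gcongr
      · filter_upwards [ae_pi_rademacher (Fin n)] with z hz k
        split_ifs
        · rw [abs_mul, abs_mul, abs_mul]
          rcases hz (f k) with h | h <;> simp [h]
        · simpa using abs_nonneg (s * a (e k))
      · intro j k z hjk
        by_cases h : f j < j
        · simp only [h, if_true]
          rw [Function.update_of_ne (h.trans_le hjk).ne]
        · simp [h]
  have hsub : {z : Fin n → ℝ | r ≤ |∑ j, a j * (z j * z (j + d))|} ⊆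
      {z | r / 2 ≤ |∑ k, z k * (if k - d < k then a (k - d) * z (k - d) else 0)|} ∪
      {z | r / 2 ≤ |∑ k, z k * (if k + d < k then a k * z (k + d) else 0)|} := by
    intro z hz
    have e : ∑ j, a j * (z j * z (j + d)) =
        ∑ k, z k * (if k - d < k then a (k - d) * z (k - d) else 0) +
        ∑ k, z k * (if k + d < k then a k * z (k + d) else 0) := by
      rw [← Equiv.sum_comp (Equiv.addRight d)
        (fun k => z k * (if k - d < k then a (k - d) * z (k - d) else 0)),
        ← Finset.sum_add_distrib]
      refine Finset.sum_congr rfl fun j _ => ?_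
      simp only [Equiv.coe_addRight, add_sub_cancel_right]
      have hne : j ≠ j + d := fun h => hd (by simpa using h)
      rcases lt_or_gt_of_ne hne with h | h
      · rw [if_pos h, if_neg h.not_gt]; ring
      · rw [if_neg (not_lt_of_gt h), if_pos h]; ring
    by_contra hc
    simp only [Set.mem_union, Set.mem_ofPred_eq, not_or, not_le] at hc hz
    rw [e] at hz
    have := abs_add_le (∑ k, z k * (if k - d < k then a (k - d) * z (k - d) else 0))
      (∑ k, z k * (if k + d < k then a k * z (k + d) else 0))
    linarith [hc.1, hc.2]
  refine (measure_mono hsub).trans ((measure_union_le _ _).trans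
    ((add_le_add (key _ _ sub_left_injective) (key id _ Function.injective_id)).trans
      (le_of_eq ?_)))
  rw [← ENNReal.ofReal_add (by positivity) (by positivity)]
  congr 1
  rw [show (r / 2) ^ 2 / (2 * A) = r ^ 2 / (8 * A) by field_simp; norm_num]
  ring

/-! ### The two observation models -/

lemma measurable_sgn : Measurable sgn :=
  Measurable.ite measurableSet_Ici measurable_const measurable_const

lemma sgn_eq_one_or (x : ℝ) : sgn x = 1 ∨ sgn x = -1 := by
  unfold sgn; split_ifs <;> simp

/-- The condition `F x + F (-x) = 1` on the distribution function rules out atoms, so that it says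
precisely that the law is symmetric. -/
lemma map_neg_eq_of_cdf_symm (ν : Measure ℝ) [IsProbabilityMeasure ν]
    (h : ∀ x : ℝ, cdf ν x + cdf ν (-x) = 1) : ν.map (fun x => -x) = ν := by
  have hp : IsProbabilityMeasure (ν.map fun x : ℝ => -x) :=
    Measure.isProbabilityMeasure_map (by fun_prop)
  refine Measure.eq_of_cdf _ _ ?_
  ext x
  have hIic : ∀ y, cdf (ν.map fun x : ℝ => -x) y = ν.real (Set.Ici (-y)) := fun y => by
    rw [cdf_eq_real, map_measureReal_apply (by fun_prop) measurableSet_Iic]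
    congr 1
    ext z
    simp
  have hIoi : ∀ y, ν.real (Set.Ioi (-y)) = cdf ν y := fun y => by
    have := h y
    rw [← Set.compl_Iic, measureReal_compl measurableSet_Iic, ← cdf_eq_real, probReal_univ]
    linarith
  refine le_antisymm ?_ ?_
  · have hle : ∀ y ∈ Set.Ioi x, cdf (ν.map fun x : ℝ => -x) x ≤ cdf ν y := fun y hy => by
      rw [hIic, ← hIoi]
      exact measureReal_mono (fun z hz => (neg_lt_neg (Set.mem_Ioi.1 hy)).trans_le hz)
    have hc : ContinuousWithinAt (cdf ν) (Set.Ioi x) x :=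
      ((cdf ν).right_continuous x).mono Set.Ioi_subset_Ici_self
    exact ge_of_tendsto hc (Filter.eventually_of_mem self_mem_nhdsWithin hle)
  · rw [hIic, ← hIoi]
    exact measureReal_mono Set.Ioi_subset_Ici_self

lemma gaussianReal_Icc_le (u c : ℝ) :
    gaussianReal 0 1 (Set.Icc u (u + c)) ≤ ENNReal.ofReal (c / 2) := by
  rw [gaussianReal_apply _ one_ne_zero]
  have h : ∀ x, gaussianPDF 0 1 x ≤ ENNReal.ofReal (1 / 2) := by
    intro x
    refine ENNReal.ofReal_le_ofReal ?_
    rw [gaussianPDFReal]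
    have h1 : (2 : ℝ) ≤ Real.sqrt (2 * Real.pi * (1 : ℝ≥0)) := by
      refine Real.le_sqrt_of_sq_le ?_
      have := Real.pi_gt_three
      simp only [NNReal.coe_one]
      linarith
    have h2 : (Real.sqrt (2 * Real.pi * (1 : ℝ≥0)))⁻¹ ≤ 1 / 2 := by
      rw [one_div]; exact inv_anti₀ (by norm_num) h1
    have h3 : Real.exp (-(x - 0) ^ 2 / (2 * (1 : ℝ≥0))) ≤ 1 :=
      Real.exp_le_one_iff.2 (div_nonpos_of_nonpos_of_nonneg (by nlinarith [sq_nonneg (x - 0)])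
        (by simp))
    calc _ ≤ (1 / 2 : ℝ) * 1 := mul_le_mul h2 h3 (Real.exp_pos _).le (by norm_num)
      _ = _ := by norm_num
  refine (lintegral_mono h).trans (le_of_eq ?_)
  rw [setLIntegral_const, Real.volume_Icc, ← ENNReal.ofReal_mul (by norm_num)]
  congr 1
  ring

/-- If `e` has a symmetric law and `z` is an independent standard Gaussian, then `sgn (z + c + e)`
takes each of its values with probability at most `(1 + |c|) / 2`: the sum `z + e` is symmetric and
its density is at most `1 / 2`. -/
lemma measure_sgn_add_eq_le (ν : Measure ℝ) [IsProbabilityMeasure ν]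
    (hν : ν.map (fun x => -x) = ν) (c s : ℝ) (hs : s = 1 ∨ s = -1) :
    (ν.prod (gaussianReal 0 1)) {q | sgn (q.2 + c + q.1) = s} ≤ ENNReal.ofReal ((1 + |c|) / 2) := by
  set P := ν.prod (gaussianReal 0 1) with hP
  have hwin : ∀ u d : ℝ,
      P {q | q.2 + q.1 ∈ Set.Icc u (u + d)} ≤ ENNReal.ofReal (d / 2) := by
    intro u d
    have hm : MeasurableSet {q : ℝ × ℝ | q.2 + q.1 ∈ Set.Icc u (u + d)} :=
      (measurable_snd.add measurable_fst) measurableSet_Icc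
    rw [hP, Measure.prod_apply hm]
    refine (lintegral_mono fun w => ?_).trans
      ((lintegral_const _).trans (by rw [measure_univ, mul_one])).le
    convert! gaussianReal_Icc_le (u - w) d using 2
    ext z
    simp only [Set.mem_preimage, Set.mem_ofPred_eq, Set.mem_Icc]
    constructor <;> rintro ⟨h1, h2⟩ <;> constructor <;> linarith
  have hneg : MeasurePreserving (fun q : ℝ × ℝ => (-q.1, -q.2)) P P := by
    have h1 : MeasurePreserving (fun x : ℝ => -x) ν ν := ⟨measurable_neg, hν⟩
    have h2 : MeasurePreserving (fun x : ℝ => -x) (gaussianReal 0 1) (gaussianReal 0 1) :=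
      ⟨measurable_neg, by rw [gaussianReal_map_neg, neg_zero]⟩
    exact h1.prod h2
  have hm1 : MeasurableSet {q : ℝ × ℝ | 0 ≤ q.2 + q.1} :=
    measurableSet_le measurable_const (by fun_prop)
  have hm2 : MeasurableSet {q : ℝ × ℝ | q.2 + q.1 ≤ 0} :=
    measurableSet_le (by fun_prop) measurable_const
  have hsym : P {q | 0 ≤ q.2 + q.1} = P {q | q.2 + q.1 ≤ 0} := by
    rw [← hneg.measure_preimage hm1.nullMeasurableSet]
    congr 1
    ext q
    simp only [Set.mem_preimage, Set.mem_ofPred_eq]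
    constructor <;> intro h <;> linarith
  have hhalf : P {q | 0 ≤ q.2 + q.1} ≤ ENNReal.ofReal (1 / 2) := by
    have hu := measure_union_add_inter (μ := P) {q : ℝ × ℝ | 0 ≤ q.2 + q.1} hm2
    have h1 : {q : ℝ × ℝ | 0 ≤ q.2 + q.1} ∪ {q | q.2 + q.1 ≤ 0} = Set.univ := by
      ext q; simpa using le_total 0 (q.2 + q.1)
    have h2 : P ({q : ℝ × ℝ | 0 ≤ q.2 + q.1} ∩ {q | q.2 + q.1 ≤ 0}) = 0 := by
      refine le_antisymm ((measure_mono fun q hq => ?_).trans ((hwin 0 0).trans (by simp)))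
        zero_le
      exact ⟨hq.1, hq.2.trans_eq (add_zero 0).symm⟩
    rw [h1, h2, measure_univ, add_zero, ← hsym, ← two_mul] at hu
    have h3 : ENNReal.ofReal (1 / 2) = 2⁻¹ := by
      rw [one_div, ENNReal.ofReal_inv_of_pos (by norm_num), ENNReal.ofReal_ofNat]
    rw [h3]
    refine le_of_eq ?_
    rw [← mul_one (2⁻¹ : ℝ≥0∞), hu, ← mul_assoc, ENNReal.inv_mul_cancel (by simp) (by simp),
      one_mul]
  have hfin : ENNReal.ofReal ((1 + |c|) / 2) =
      ENNReal.ofReal (1 / 2) + ENNReal.ofReal (|c| / 2) := by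
    rw [← ENNReal.ofReal_add (by norm_num) (by positivity)]; congr 1; ring
  rw [hfin]
  rcases hs with rfl | rfl
  · refine (measure_mono (t := {q : ℝ × ℝ | 0 ≤ q.2 + q.1} ∪
      {q | q.2 + q.1 ∈ Set.Icc (-|c|) (-|c| + |c|)}) fun q hq => ?_).trans
      ((measure_union_le _ _).trans (add_le_add hhalf (hwin _ _)))
    have h0 : 0 ≤ q.2 + c + q.1 := by
      by_contra hn
      have : sgn (q.2 + c + q.1) = 1 := hq
      rw [sgn, if_neg hn] at this
      norm_num at this
    by_cases h : 0 ≤ q.2 + q.1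
    · exact Or.inl h
    · right
      have := le_abs_self c
      constructor <;> linarith
  · refine (measure_mono (t := {q : ℝ × ℝ | q.2 + q.1 ≤ 0} ∪
      {q | q.2 + q.1 ∈ Set.Icc 0 (0 + |c|)}) fun q hq => ?_).trans
      ((measure_union_le _ _).trans (add_le_add (hsym ▸ hhalf) (hwin _ _)))
    have h0 : ¬ 0 ≤ q.2 + c + q.1 := by
      intro hn
      have : sgn (q.2 + c + q.1) = -1 := hq
      rw [sgn, if_pos hn] at this
      norm_num at this
    by_cases h : q.2 + q.1 ≤ 0
    · exact Or.inl h
    · right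
      have := neg_abs_le c
      constructor <;> linarith

lemma IsOneBitModel.isProbabilityMeasure {Θ : ℝ → ℝ → ℝ} {ν : Measure ℝ}
    (h : IsOneBitModel Θ ν) : IsProbabilityMeasure ν := by
  cases h with
  | bitFlip p hp0 hp => exact isProbabilityMeasure_signLaw hp0 (by linarith)
  | additive ν hν _ => exact hν

lemma IsOneBitModel.measurable {Θ : ℝ → ℝ → ℝ} {ν : Measure ℝ}
    (h : IsOneBitModel Θ ν) : Measurable fun q : ℝ × ℝ => Θ q.1 q.2 := by
  cases h with
  | bitFlip p hp0 hp => exact measurable_fst.mul (measurable_sgn.comp measurable_snd)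
  | additive ν hν _ => exact measurable_sgn.comp (measurable_snd.add measurable_fst)

lemma IsOneBitModel.ae_eq_one_or {Θ : ℝ → ℝ → ℝ} {ν : Measure ℝ}
    (h : IsOneBitModel Θ ν) : ∀ᵐ w ∂ν, ∀ z, Θ w z = 1 ∨ Θ w z = -1 := by
  cases h with
  | bitFlip p hp0 hp =>
    filter_upwards [ae_signLaw p] with w hw z
    rcases hw with rfl | rfl <;> rcases sgn_eq_one_or z with h | h <;> simp [h]
  | additive ν hν _ => exact Filter.Eventually.of_forall fun w z => sgn_eq_one_or _

/-- In both observation models a shift by `c` of a standard Gaussian input biases the output bit by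
at most `|c|`. -/
lemma IsOneBitModel.measure_shift_eq_le {Θ : ℝ → ℝ → ℝ} {ν : Measure ℝ}
    (h : IsOneBitModel Θ ν) (c s : ℝ) (hs : s = 1 ∨ s = -1) :
    (ν.prod (gaussianReal 0 1)) {q | Θ q.1 (q.2 + c) = s} ≤ ENNReal.ofReal ((1 + |c|) / 2) := by
  cases h with
  | bitFlip p hp0 hp =>
    have := isProbabilityMeasure_signLaw hp0 (show p ≤ 1 by linarith)
    -- the noiseless sign is the additive model with noise `0`
    have hnoiseless : ∀ s : ℝ, s = 1 ∨ s = -1 →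
        gaussianReal 0 1 {z | sgn (z + c) = s} ≤ ENNReal.ofReal ((1 + |c|) / 2) := by
      intro s hs
      have h1 := measure_sgn_add_eq_le (Measure.dirac 0)
        (by rw [Measure.map_dirac' measurable_neg, neg_zero]) c s hs
      have hm : MeasurableSet {q : ℝ × ℝ | sgn (q.2 + c + q.1) = s} :=
        (measurable_sgn.comp (by fun_prop)) (measurableSet_singleton s)
      rw [Measure.prod_apply hm, lintegral_dirac] at h1
      simpa using h1
    have hm : MeasurableSet {q : ℝ × ℝ | q.1 * sgn (q.2 + c) = s} :=
      (measurable_fst.mul (measurable_sgn.comp (measurable_snd.add_const c)))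
        (measurableSet_singleton s)
    rw [Measure.prod_apply hm]
    refine (lintegral_mono_ae ?_).trans
      ((lintegral_const _).trans (by rw [measure_univ, mul_one])).le
    filter_upwards [ae_signLaw p] with τ hτ
    rcases hτ with rfl | rfl
    · simpa using hnoiseless s hs
    · have := hnoiseless (-s) (by rcases hs with rfl | rfl <;> simp)
      refine le_trans (le_of_eq ?_) this
      congr 1
      ext z
      simp [neg_eq_iff_eq_neg]
  | additive ν hν hsymm =>
    exact measure_sgn_add_eq_le ν (map_neg_eq_of_cdf_symm ν hsymm) c s hs

lemma IsOneBitModel.abs_corr_le_one {Θ : ℝ → ℝ → ℝ} {ν : Measure ℝ}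
    (h : IsOneBitModel Θ ν) : |corr Θ ν| ≤ 1 := by
  have := h.isProbabilityMeasure
  have h1 : ∀ᵐ q ∂(ν.prod (gaussianReal 0 1)), ‖Θ q.1 q.2 * q.2‖ ≤ (1 + q.2 ^ 2) / 2 := by
    have h2 := (Measure.quasiMeasurePreserving_fst (μ := ν) (ν := gaussianReal 0 1)).ae
      h.ae_eq_one_or
    filter_upwards [h2] with q hq
    have h3 : ‖Θ q.1 q.2 * q.2‖ = |q.2| := by
      rw [norm_mul, Real.norm_eq_abs, Real.norm_eq_abs]
      rcases hq q.2 with h | h <;> simp [h]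
    rw [h3]
    nlinarith [sq_abs q.2, sq_nonneg (|q.2| - 1)]
  have hI : Integrable (fun x : ℝ => x ^ 2) (gaussianReal 0 1) :=
    (memLp_id_gaussianReal 2).integrable_sq
  have hI2 : Integrable (fun x : ℝ => (1 + x ^ 2) / 2) (gaussianReal 0 1) :=
    ((integrable_const 1).add hI).div_const 2
  have hvar : ∫ x, x ^ 2 ∂(gaussianReal 0 1) = 1 := by
    have h1 := variance_fun_id_gaussianReal (μ := 0) (v := 1)
    rw [variance_eq_integral (by fun_prop)] at h1
    simpa using h1
  rw [corr, ← Real.norm_eq_abs]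
  refine (norm_integral_le_of_norm_le (hI2.comp_snd ν) h1).trans (le_of_eq ?_)
  rw [integral_fun_snd (fun x : ℝ => (1 + x ^ 2) / 2), integral_div,
    integral_add (integrable_const 1) hI, hvar]
  simp

/-! ### Exponential moments with output bits -/

/-- The vector of signs encoded by a Boolean vector. -/
def signVec {κ : Type*} (σ : κ → Bool) : κ → ℝ := fun i => if σ i then 1 else -1

lemma signVec_eq_one_or {κ : Type*} (σ : κ → Bool) (i : κ) :
    signVec σ i = 1 ∨ signVec σ i = -1 := by
  unfold signVec; split_ifs <;> simp

lemma exists_signVec_eq {κ : Type*} (θ : κ → ℝ) (h : ∀ i, θ i = 1 ∨ θ i = -1) :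
    ∃ σ, θ = signVec σ := by
  classical
  refine ⟨fun i => decide (θ i = 1), funext fun i => ?_⟩
  rcases h i with h | h <;> simp [signVec, h]

lemma signVec_dotProduct_self {κ : Type*} [Fintype κ] (σ : κ → Bool) :
    signVec σ ⬝ᵥ signVec σ = Fintype.card κ := by
  have : ∀ i, signVec σ i * signVec σ i = 1 := fun i => by
    rcases signVec_eq_one_or σ i with h | h <;> simp [h]
  simp [dotProduct, this]

lemma sum_exp_dotProduct_signVec_le {κ : Type*} [Fintype κ] [DecidableEq κ] (a : κ → ℝ) :
    ∑ σ : κ → Bool, Real.exp (a ⬝ᵥ signVec σ) ≤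
      2 ^ Fintype.card κ * Real.exp ((∑ i, a i ^ 2) / 2) := by
  have h1 : ∀ σ : κ → Bool, Real.exp (a ⬝ᵥ signVec σ) =
      ∏ i, Real.exp (a i * if σ i then 1 else -1) := fun σ => by
    rw [← Real.exp_sum]; rfl
  simp_rw [h1]
  have h2 := Finset.prod_univ_sum (fun _ : κ => (Finset.univ : Finset Bool))
    fun i b => Real.exp (a i * if b then 1 else -1)
  rw [Fintype.piFinset_univ] at h2
  rw [← h2]
  calc _ ≤ ∏ i : κ, (2 * Real.exp (a i ^ 2 / 2)) := by
        refine Finset.prod_le_prod (fun i _ => by positivity) fun i _ => ?_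
        simpa using exp_add_exp_neg_le (a i)
    _ = _ := by
        rw [Finset.prod_mul_distrib, Finset.prod_const, Finset.card_univ, ← Real.exp_sum,
          Finset.sum_div]

/-- Sum over all sign vectors of the exponential of an `ℓ¹` norm: Jensen's inequality reduces it to
the coordinates, which are Rademacher sums. -/
lemma sum_exp_sum_abs_mulVec_le {κ : Type*} [Fintype κ] [DecidableEq κ] [Nonempty κ]
    (D : Matrix κ κ ℝ) (δ : ℝ) (hD : ∀ i k, |D i k| ≤ δ) (hδ : Fintype.card κ * δ ≤ 1) (s : ℝ) :
    ∑ σ : κ → Bool, Real.exp (2 * |s| * ∑ i, |(D *ᵥ signVec σ) i|) ≤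
      2 ^ Fintype.card κ * (2 * Real.exp (2 * s ^ 2 * Fintype.card κ)) := by
  set m : ℝ := ((Fintype.card κ : ℕ) : ℝ) with hm
  have hm0 : 0 < m := by rw [hm]; exact_mod_cast Fintype.card_pos
  have hδ0 : 0 ≤ δ := by
    obtain ⟨i⟩ := ‹Nonempty κ›
    exact (abs_nonneg _).trans (hD i i)
  have h1 : ∀ σ : κ → Bool, Real.exp (2 * |s| * ∑ i, |(D *ᵥ signVec σ) i|) ≤
      ∑ i, m⁻¹ * (Real.exp ((fun k => 2 * m * s * D i k) ⬝ᵥ signVec σ) +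
        Real.exp ((fun k => -(2 * m * s) * D i k) ⬝ᵥ signVec σ)) := by
    intro σ
    have hj := convexOn_exp.map_sum_le (t := Finset.univ) (w := fun _ : κ => m⁻¹)
      (p := fun i => 2 * m * |s| * |(D *ᵥ signVec σ) i|) (fun _ _ => by positivity)
      (by simp [hm]) (fun _ _ => Set.mem_univ _)
    simp only [smul_eq_mul] at hj
    have e : ∑ i, m⁻¹ * (2 * m * |s| * |(D *ᵥ signVec σ) i|) =
        2 * |s| * ∑ i, |(D *ᵥ signVec σ) i| := by
      rw [Finset.mul_sum]
      exact Finset.sum_congr rfl fun i _ => by field_simp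
    rw [e] at hj
    refine hj.trans (Finset.sum_le_sum fun i _ => ?_)
    refine mul_le_mul_of_nonneg_left ?_ (by positivity)
    have e1 : ∀ c : ℝ, (fun k => c * D i k) ⬝ᵥ signVec σ = c * (D *ᵥ signVec σ) i := fun c => by
      simp [dotProduct, Matrix.mulVec, Finset.mul_sum, mul_assoc]
    rw [e1, e1]
    have e2 : 2 * m * |s| * |(D *ᵥ signVec σ) i| = |2 * m * s * (D *ᵥ signVec σ) i| := by
      rw [abs_mul, abs_mul, abs_mul, abs_of_pos hm0, abs_two]
    rw [e2]
    rcases abs_choice (2 * m * s * (D *ᵥ signVec σ) i) with h | h <;> rw [h]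
    · linarith [Real.exp_pos (-(2 * m * s) * (D *ᵥ signVec σ) i)]
    · rw [← neg_mul]
      linarith [Real.exp_pos (2 * m * s * (D *ᵥ signVec σ) i)]
  have h2 : ∀ c : ℝ, c ^ 2 = (2 * m * s) ^ 2 → ∀ i,
      ∑ σ : κ → Bool, Real.exp ((fun k => c * D i k) ⬝ᵥ signVec σ) ≤
        2 ^ Fintype.card κ * Real.exp (2 * s ^ 2 * m) := by
    intro c hc i
    refine (sum_exp_dotProduct_signVec_le _).trans ?_
    gcongr
    simp_rw [mul_pow, ← Finset.mul_sum, hc]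
    have h3 : ∑ k, D i k ^ 2 ≤ m * δ ^ 2 := by
      refine (Finset.sum_le_card_nsmul _ _ (δ ^ 2) fun k _ => ?_).trans_eq (by simp [hm])
      rw [← sq_abs]
      exact pow_le_pow_left₀ (abs_nonneg _) (hD i k) 2
    have h4 : (m * δ) ^ 2 ≤ 1 := by
      have : 0 ≤ m * δ := by positivity
      nlinarith
    calc ((2 * m * s) ^ 2 * ∑ k, D i k ^ 2) / 2 ≤ (2 * m * s) ^ 2 * (m * δ ^ 2) / 2 := by
          gcongr
      _ = 2 * s ^ 2 * m * (m * δ) ^ 2 := by ring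
      _ ≤ 2 * s ^ 2 * m * 1 := by gcongr
      _ = 2 * s ^ 2 * m := mul_one _
  refine (Finset.sum_le_sum fun σ _ => h1 σ).trans ?_
  rw [Finset.sum_comm]
  calc _ ≤ ∑ i : κ, m⁻¹ * (2 ^ Fintype.card κ * (2 * Real.exp (2 * s ^ 2 * m))) := by
        refine Finset.sum_le_sum fun i _ => ?_
        rw [← Finset.mul_sum, Finset.sum_add_distrib]
        refine mul_le_mul_of_nonneg_left ?_ (by positivity)
        linarith [h2 (2 * m * s) rfl i, h2 (-(2 * m * s)) (by ring) i]
    _ = _ := by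
        rw [Finset.sum_const, Finset.card_univ, nsmul_eq_mul, ← hm, ← mul_assoc,
          mul_inv_cancel₀ hm0.ne', one_mul]

/-- The vector of output bits of a one-bit model with noise `w` on the input `y`. -/
def bits {κ : Type*} (Θ : ℝ → ℝ → ℝ) (w y : κ → ℝ) : κ → ℝ := fun i => Θ (w i) (y i)

lemma IsOneBitModel.measurable_bits {α κ : Type*} [MeasurableSpace α] {Θ : ℝ → ℝ → ℝ}
    {ν : Measure ℝ} (h : IsOneBitModel Θ ν) {w y : α → κ → ℝ} (hw : Measurable w)
    (hy : Measurable y) : Measurable fun a => bits Θ (w a) (y a) :=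
  measurable_pi_lambda _ fun i => h.measurable.comp
    (((measurable_pi_apply i).comp hw).prodMk ((measurable_pi_apply i).comp hy))

/-- The probability of a given output bit pattern for independent standard Gaussian inputs shifted
by `c`. -/
lemma IsOneBitModel.lintegral_bits_shift_le {κ : Type*} [Fintype κ] {Θ : ℝ → ℝ → ℝ}
    {ν : Measure ℝ} (h : IsOneBitModel Θ ν) (c : κ → ℝ) (σ : κ → Bool) :
    ∫⁻ w, ∫⁻ y, ({y | bits Θ w (y + c) = signVec σ}.indicator 1 y : ℝ≥0∞)
        ∂(Measure.pi fun _ : κ => gaussianReal 0 1) ∂(Measure.pi fun _ : κ => ν) ≤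
      ENNReal.ofReal ((2 ^ Fintype.card κ)⁻¹ * Real.exp (∑ i, |c i|)) := by
  have := h.isProbabilityMeasure
  set f : κ → ℝ × ℝ → ℝ≥0∞ := fun i => {q | Θ q.1 (q.2 + c i) = signVec σ i}.indicator 1 with hf
  have hfm : ∀ i, Measurable (f i) := fun i => by
    refine measurable_one.indicator ?_
    exact (h.measurable.comp (measurable_fst.prodMk (measurable_snd.add_const _)))
      (measurableSet_singleton (signVec σ i))
  have hprod : ∀ w y : κ → ℝ, ({y | bits Θ w (y + c) = signVec σ}.indicator 1 y : ℝ≥0∞) =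
      ∏ i, f i (w i, y i) := by
    intro w y
    by_cases hy : bits Θ w (y + c) = signVec σ
    · rw [Set.indicator_of_mem (by exact hy)]
      refine (Finset.prod_eq_one fun i _ => ?_).symm
      exact Set.indicator_of_mem (s := {q : ℝ × ℝ | Θ q.1 (q.2 + c i) = signVec σ i})
        (congrFun hy i) 1
    · rw [Set.indicator_of_notMem (by exact hy)]
      obtain ⟨i, hi⟩ := Function.ne_iff.1 hy
      exact (Finset.prod_eq_zero (Finset.mem_univ i) (Set.indicator_of_notMem
        (s := {q : ℝ × ℝ | Θ q.1 (q.2 + c i) = signVec σ i}) hi 1)).symm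
  simp_rw [hprod]
  have h1 : ∀ w : κ → ℝ, ∫⁻ y, ∏ i, f i (w i, y i) ∂(Measure.pi fun _ : κ => gaussianReal 0 1) =
      ∏ i, ∫⁻ x, f i (w i, x) ∂(gaussianReal 0 1) := fun w =>
    lintegral_pi_prod (fun _ : κ => gaussianReal 0 1) (fun i x => f i (w i, x))
      fun i => (hfm i).comp measurable_prodMk_left
  simp_rw [h1]
  rw [lintegral_pi_prod (fun _ : κ => ν) (fun i u => ∫⁻ x, f i (u, x) ∂(gaussianReal 0 1))
    fun i => (hfm i).lintegral_prod_right']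
  have h2 : ∀ i, ∫⁻ u, ∫⁻ x, f i (u, x) ∂(gaussianReal 0 1) ∂ν ≤
      ENNReal.ofReal (2⁻¹ * Real.exp |c i|) := by
    intro i
    rw [← lintegral_prod _ (hfm i).aemeasurable]
    simp only [hf]
    have hm : MeasurableSet {q : ℝ × ℝ | Θ q.1 (q.2 + c i) = signVec σ i} :=
      (h.measurable.comp (measurable_fst.prodMk (measurable_snd.add_const _)))
        (measurableSet_singleton (signVec σ i))
    rw [lintegral_indicator_one hm]
    refine (h.measure_shift_eq_le (c i) _ (signVec_eq_one_or σ i)).trans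
      (ENNReal.ofReal_le_ofReal ?_)
    have := Real.add_one_le_exp |c i|
    linarith
  refine (Finset.prod_le_prod' fun i _ => h2 i).trans (le_of_eq ?_)
  rw [← ENNReal.ofReal_prod_of_nonneg fun i _ => by positivity, Finset.prod_mul_distrib,
    Finset.prod_const, Finset.card_univ, ← Real.exp_sum, inv_pow]

/-- Exponential moment of a linear form of a Gaussian vector `z` whose coefficients `b` depend on
the output bits of the orthonormal measurements `W z`. Splitting according to the bit pattern, the
Cameron–Martin formula turns the exponential into a shift of the measurements. -/
lemma IsOneBitModel.lintegral_exp_bits_le {ι κ : Type*} [Fintype ι] [Fintype κ] [DecidableEq ι]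
    [DecidableEq κ] {Θ : ℝ → ℝ → ℝ} {ν : Measure ℝ} (h : IsOneBitModel Θ ν)
    (W : Matrix κ ι ℝ) (hW : W * Wᵀ = 1) (b : (κ → ℝ) → ι → ℝ) :
    ∫⁻ p : (ι → ℝ) × (κ → ℝ), ENNReal.ofReal (Real.exp (b (bits Θ p.2 (W *ᵥ p.1)) ⬝ᵥ p.1))
        ∂((Measure.pi fun _ : ι => gaussianReal 0 1).prod (Measure.pi fun _ : κ => ν)) ≤
      ENNReal.ofReal (∑ σ : κ → Bool, Real.exp (b (signVec σ) ⬝ᵥ b (signVec σ) / 2) *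
        ((2 ^ Fintype.card κ)⁻¹ * Real.exp (∑ i, |(W *ᵥ b (signVec σ)) i|))) := by
  have := h.isProbabilityMeasure
  set S : (κ → Bool) → Set ((ι → ℝ) × (κ → ℝ)) :=
    fun σ => {p | bits Θ p.2 (W *ᵥ p.1) = signVec σ} with hS
  have hSm : ∀ σ, MeasurableSet (S σ) := fun σ =>
    h.measurable_bits measurable_snd (by fun_prop) (measurableSet_singleton (signVec σ))
  set E : (κ → Bool) → (ι → ℝ) × (κ → ℝ) → ℝ≥0∞ := fun σ p =>
    (S σ).indicator 1 p * ENNReal.ofReal (Real.exp (b (signVec σ) ⬝ᵥ p.1)) with hE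
  have hEm : ∀ σ, Measurable (E σ) := fun σ => by
    refine (measurable_one.indicator (hSm σ)).mul ?_
    fun_prop
  -- almost surely the bits are `± 1`, so one of the patterns occurs
  have hae : ∀ᵐ p ∂((Measure.pi fun _ : ι => gaussianReal 0 1).prod (Measure.pi fun _ : κ => ν)),
      ENNReal.ofReal (Real.exp (b (bits Θ p.2 (W *ᵥ p.1)) ⬝ᵥ p.1)) ≤ ∑ σ, E σ p := by
    have h1 : ∀ᵐ w ∂(Measure.pi fun _ : κ => ν), ∀ i, ∀ z, Θ (w i) z = 1 ∨ Θ (w i) z = -1 := by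
      rw [ae_all_iff]
      exact fun i => (Measure.quasiMeasurePreserving_eval (fun _ : κ => ν) i).ae h.ae_eq_one_or
    filter_upwards [Measure.quasiMeasurePreserving_snd.ae h1] with p hp
    obtain ⟨σ, hσ⟩ := exists_signVec_eq (bits Θ p.2 (W *ᵥ p.1)) fun i => hp i _
    refine le_trans (le_of_eq ?_)
      (Finset.single_le_sum (f := fun σ => E σ p) (fun _ _ => zero_le) (Finset.mem_univ σ))
    simp only [hE]
    rw [Set.indicator_of_mem (show p ∈ S σ from hσ), Pi.one_apply, one_mul, ← hσ]
  refine (lintegral_mono_ae hae).trans ?_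
  rw [lintegral_finsetSum _ fun σ _ => hEm σ,
    ENNReal.ofReal_sum_of_nonneg fun σ _ => by positivity]
  refine Finset.sum_le_sum fun σ _ => ?_
  rw [lintegral_prod_symm _ (hEm σ).aemeasurable]
  have hSw : ∀ w : κ → ℝ, MeasurableSet {y : κ → ℝ | bits Θ w y = signVec σ} := fun w =>
    h.measurable_bits measurable_const measurable_id (measurableSet_singleton (signVec σ))
  have h2 : ∀ w : κ → ℝ, ∫⁻ z, E σ (z, w) ∂(Measure.pi fun _ : ι => gaussianReal 0 1) =
      ENNReal.ofReal (Real.exp (b (signVec σ) ⬝ᵥ b (signVec σ) / 2)) *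
        ∫⁻ y, ({y | bits Θ w (y + W *ᵥ b (signVec σ)) = signVec σ}.indicator 1 y : ℝ≥0∞)
          ∂(Measure.pi fun _ : κ => gaussianReal 0 1) := by
    intro w
    have h3 := lintegral_gaussian_mul_exp (b (signVec σ))
      (fun z => (S σ).indicator 1 (z, w))
      ((measurable_one.indicator (hSm σ)).comp measurable_prodMk_right)
    simp only [hE]
    rw [h3]
    congr 1
    have hm : MeasurableSet {y | bits Θ w (y + W *ᵥ b (signVec σ)) = signVec σ} :=
      (hSw w).preimage (measurable_add_const _)
    rw [← (measurePreserving_gaussian_mulVec W hW).lintegral_comp (measurable_one.indicator hm)]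
    refine lintegral_congr fun z => ?_
    have e : W *ᵥ (z + b (signVec σ)) = W *ᵥ z + W *ᵥ b (signVec σ) := Matrix.mulVec_add _ _ _
    simp only [Set.indicator_apply, hS, Set.mem_ofPred_eq, e, Pi.one_apply]
  simp_rw [h2]
  rw [lintegral_const_mul', ENNReal.ofReal_mul (Real.exp_pos _).le]
  · gcongr
    exact h.lintegral_bits_shift_le _ σ
  · exact ENNReal.ofReal_ne_top

/-- Tail bound for a bilinear form in the output bits of the measurements `U g` and the coordinates
`V g`, for nearly orthonormal measurements. The decorrelating change of measure reduces it to
orthonormal measurements, and there the exponential moments are sub-Gaussian. -/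
lemma IsOneBitModel.measure_abs_bits_ge_le {ι κ : Type*} [Fintype ι] [Fintype κ] [DecidableEq ι]
    [DecidableEq κ] [Nonempty κ] {Θ : ℝ → ℝ → ℝ} {ν : Measure ℝ} (h : IsOneBitModel Θ ν)
    (U V : Matrix κ ι ℝ) (hdiag : ∀ i, (U * Uᵀ) i i = 1)
    (hoff : ∀ i k, i ≠ k → |(U * Uᵀ) i k| ≤ 1 / (2 * Fintype.card κ))
    (hV : V * Vᵀ = 1) (δ : ℝ) (hUV : ∀ i k, |(U * Vᵀ) i k| ≤ δ) (hδ : Fintype.card κ * δ ≤ 1)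
    (r : ℝ) (hr : 0 ≤ r) :
    ((Measure.pi fun _ : ι => gaussianReal 0 1).prod (Measure.pi fun _ : κ => ν))
        {p | r ≤ |bits Θ p.2 (U *ᵥ p.1) ⬝ᵥ (V *ᵥ p.1)|} ≤
      ENNReal.ofReal (4 * Real.exp (-(r ^ 2 / (24 * Fintype.card κ)))) := by
  have := h.isProbabilityMeasure
  obtain ⟨A, hA1, hA2, hA3, hA4⟩ := exists_decorrelation U hdiag hoff
  set m : ℝ := ((Fintype.card κ : ℕ) : ℝ) with hm
  have hm0 : 0 < m := by rw [hm]; exact_mod_cast Fintype.card_pos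
  set F : (ι → ℝ) × (κ → ℝ) → ℝ := fun p => bits Θ p.2 (U *ᵥ p.1) ⬝ᵥ (V *ᵥ p.1) with hF
  have hFm : Measurable F := by
    have h1 : Measurable fun p : (ι → ℝ) × (κ → ℝ) => bits Θ p.2 (U *ᵥ p.1) :=
      h.measurable_bits measurable_snd (by fun_prop)
    exact Finset.measurable_fun_sum _ fun i _ =>
      ((measurable_pi_apply i).comp h1).mul (by fun_prop)
  have hT : Measurable fun p : (ι → ℝ) × (κ → ℝ) => (A *ᵥ p.1, p.2) := by fun_prop
  set γ := Measure.pi fun _ : ι => gaussianReal 0 1 with hγ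
  set N := Measure.pi fun _ : κ => ν with hN
  -- exponential moments under the decorrelated law
  have hmgf : ∀ s : ℝ, ∫⁻ p, ENNReal.ofReal (Real.exp (s * F (A *ᵥ p.1, p.2))) ∂(γ.prod N) ≤
      ENNReal.ofReal (2 * Real.exp (s ^ 2 * (6 * m) / 2)) := by
    intro s
    have h1 := h.lintegral_exp_bits_le (U * A) hA1
      (fun θ => s • (Aᵀ *ᵥ (θ ᵥ* V)))
    have e1 : ∀ p : (ι → ℝ) × (κ → ℝ), s * F (A *ᵥ p.1, p.2) =
        (s • (Aᵀ *ᵥ (bits Θ p.2 ((U * A) *ᵥ p.1) ᵥ* V))) ⬝ᵥ p.1 := fun p => by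
      simp only [hF]
      rw [smul_dotProduct, smul_eq_mul, Matrix.mulVec_mulVec, Matrix.dotProduct_mulVec,
        Matrix.dotProduct_mulVec, Matrix.mulVec_transpose]
    simp_rw [e1]
    refine h1.trans (ENNReal.ofReal_le_ofReal ?_)
    have hv : ∀ σ : κ → Bool, (signVec σ ᵥ* V) ⬝ᵥ (signVec σ ᵥ* V) = m := fun σ => by
      rw [← Matrix.mulVec_transpose, Matrix.dotProduct_mulVec, Matrix.vecMul_transpose,
        Matrix.mulVec_mulVec, hV, Matrix.one_mulVec, signVec_dotProduct_self]
    have h2 : ∀ σ : κ → Bool,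
        Real.exp ((s • (Aᵀ *ᵥ (signVec σ ᵥ* V))) ⬝ᵥ (s • (Aᵀ *ᵥ (signVec σ ᵥ* V))) / 2) *
          ((2 ^ Fintype.card κ)⁻¹ *
            Real.exp (∑ i, |((U * A) *ᵥ (s • (Aᵀ *ᵥ (signVec σ ᵥ* V)))) i|)) ≤
        Real.exp (s ^ 2 * m) * ((2 ^ Fintype.card κ)⁻¹ *
          Real.exp (2 * |s| * ∑ i, |((U * Vᵀ) *ᵥ signVec σ) i|)) := by
      intro σ
      refine mul_le_mul (Real.exp_le_exp.2 ?_) (mul_le_mul_of_nonneg_left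
        (Real.exp_le_exp.2 ?_) (by positivity)) (by positivity) (by positivity)
      · rw [smul_dotProduct, dotProduct_smul, smul_eq_mul, smul_eq_mul]
        have := hA3 (signVec σ ᵥ* V)
        rw [hv] at this
        nlinarith [sq_nonneg s]
      · simp only [Matrix.mulVec_smul, Pi.smul_apply, smul_eq_mul, abs_mul]
        rw [← Finset.mul_sum]
        have := hA2 (signVec σ ᵥ* V)
        rw [← Matrix.mulVec_transpose, Matrix.mulVec_mulVec (v := signVec σ) (M := U)] at this
        rw [← Matrix.mulVec_transpose]
        nlinarith [abs_nonneg s]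
    refine (Finset.sum_le_sum fun σ _ => h2 σ).trans ?_
    rw [← Finset.mul_sum, ← Finset.mul_sum]
    have h3 := sum_exp_sum_abs_mulVec_le (U * Vᵀ) δ hUV hδ s
    calc _ ≤ Real.exp (s ^ 2 * m) * ((2 ^ Fintype.card κ)⁻¹ *
          (2 ^ Fintype.card κ * (2 * Real.exp (2 * s ^ 2 * m)))) := by gcongr
      _ = 2 * (Real.exp (s ^ 2 * m) * Real.exp (2 * s ^ 2 * m)) := by
          rw [← mul_assoc (2 ^ Fintype.card κ : ℝ)⁻¹, inv_mul_cancel₀ (by positivity), one_mul]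
          ring
      _ = _ := by rw [← Real.exp_add]; congr 2; ring
  have hQ := measure_abs_ge_le_of_mgf (γ.prod N) (fun p => F (A *ᵥ p.1, p.2)) (hFm.comp hT)
    2 (6 * m) r (by positivity) hr hmgf
  set S : Set ((ι → ℝ) × (κ → ℝ)) := {p | r ≤ |F p|} with hS
  have hSm : MeasurableSet S := measurableSet_le measurable_const hFm.abs
  -- compare with the law of `A g`; an indicator is at least its square
  have h1 : ((γ.prod N) S) ^ 2 ≤ 2 * ENNReal.ofReal (4 * Real.exp (-(r ^ 2 / (12 * m)))) := by
    rw [Measure.prod_apply hSm]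
    refine (hA4 _ (measurable_measure_prodMk_left hSm)).trans ?_
    gcongr
    have e : γ.prod N {p | r ≤ |F (A *ᵥ p.1, p.2)|} =
        ∫⁻ z, N (Prod.mk (A *ᵥ z) ⁻¹' S) ∂γ := by
      rw [show {p | r ≤ |F (A *ᵥ p.1, p.2)|} = (fun p : (ι → ℝ) × (κ → ℝ) =>
        (A *ᵥ p.1, p.2)) ⁻¹' S from rfl, Measure.prod_apply (hT hSm)]
      rfl
    refine le_trans (lintegral_mono fun z => ?_) (e.symm.le.trans (hQ.trans (le_of_eq ?_)))
    · rw [sq]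
      exact mul_le_of_le_one_left' prob_le_one
    · congr 3
      · norm_num
      · congr 2; ring
  have h2 : (γ.prod N) S ^ 2 ≤ ENNReal.ofReal (4 * Real.exp (-(r ^ 2 / (24 * m)))) ^ 2 := by
    refine h1.trans ?_
    rw [← ENNReal.ofReal_pow (by positivity), ← ENNReal.ofReal_ofNat 2,
      ← ENNReal.ofReal_mul (by norm_num)]
    refine ENNReal.ofReal_le_ofReal ?_
    rw [mul_pow, ← Real.exp_nat_mul]
    have e : ((2 : ℕ) : ℝ) * -(r ^ 2 / (24 * m)) = -(r ^ 2 / (12 * m)) := by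
      push_cast; field_simp; ring
    rw [e]
    nlinarith [Real.exp_pos (-(r ^ 2 / (12 * m)))]
  exact (ENNReal.pow_le_pow_left_iff two_ne_zero).1 h2

/-! ### Partial circulant matrices with column sign flips -/

/-- The matrix whose rows `i ∈ S` are the cyclic shifts `j ↦ u (j + i)` of `u`. -/
def shiftRows {n : ℕ} (S : Finset (Fin n)) (u : Fin n → ℝ) : Matrix S (Fin n) ℝ :=
  Matrix.of fun i j => u (j + i)

/-- The matrix that selects the coordinates `l - i`, `i ∈ S`. -/
def selectRows {n : ℕ} (S : Finset (Fin n)) (l : Fin n) : Matrix S (Fin n) ℝ :=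
  Matrix.of fun i j => if l - i = j then 1 else 0

section

variable {n : ℕ} (S : Finset (Fin n))

lemma sensing_mulVec (g ξ x : Fin n → ℝ) (i : S) :
    (sensing S g ξ *ᵥ x) i = ∑ j, g (j - i) * (ξ j * x j) := by
  rw [sensing, ← Matrix.mulVec_mulVec, Matrix.mulVec, dotProduct]
  refine Finset.sum_congr rfl fun j _ => ?_
  rw [Matrix.mulVec_diagonal]
  rfl

lemma selectRows_mulVec (l : Fin n) (g : Fin n → ℝ) (i : S) :
    (selectRows S l *ᵥ g) i = g (l - i) := by
  simp [selectRows, Matrix.mulVec, dotProduct]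

lemma partialCirc_transpose_mulVec (g : Fin n → ℝ) (b : S → ℝ) (l : Fin n) :
    ((partialCirc S g)ᵀ *ᵥ b) l = b ⬝ᵥ (selectRows S l *ᵥ g) := by
  simp_rw [dotProduct, selectRows_mulVec]
  refine Finset.sum_congr rfl fun i _ => ?_
  rw [mul_comm]
  rfl

lemma shiftRows_mul_selectRows_transpose (u : Fin n → ℝ) (l : Fin n) (i k : S) :
    (shiftRows S u * (selectRows S l)ᵀ) i k = u (l - k + i) := by
  simp [Matrix.mul_apply, shiftRows, selectRows]

lemma abs_mul_apply_of_sign {ξ : Fin n → ℝ} (hξ : ∀ j, ξ j = 1 ∨ ξ j = -1) (x : Fin n → ℝ)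
    (j : Fin n) : |(ξ * x) j| = |x j| := by
  rcases hξ j with h | h <;> simp [h]

lemma IsOneBitModel.measurable_obs {Θ : ℝ → ℝ → ℝ} {ν : Measure ℝ} (h : IsOneBitModel Θ ν)
    (x : Fin n → ℝ) : Measurable fun q : (Fin n → ℝ) × (Fin n → ℝ) × (S → ℝ) =>
      obs S Θ x q.1 q.2.1 q.2.2 := by
  refine h.measurable_bits (w := fun q : (Fin n → ℝ) × (Fin n → ℝ) × (S → ℝ) => q.2.2)
    (y := fun q => sensing S q.2.1 q.1 *ᵥ x) (by fun_prop) ?_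
  refine measurable_pi_lambda _ fun i => ?_
  simp_rw [sensing_mulVec]
  fun_prop

variable [NeZero n]

/-- The measurements as linear forms in the Gaussian vector. -/
lemma sensing_mulVec_eq (g ξ x : Fin n → ℝ) :
    sensing S g ξ *ᵥ x = shiftRows S (ξ * x) *ᵥ g := by
  funext i
  rw [sensing_mulVec, ← Equiv.sum_comp (Equiv.addRight (i : Fin n))]
  refine Finset.sum_congr rfl fun j _ => ?_
  simp [shiftRows, mul_comm]

lemma selectRows_mul_transpose (l : Fin n) : selectRows S l * (selectRows S l)ᵀ = 1 := by
  ext i k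
  rw [Matrix.mul_apply, Matrix.one_apply]
  by_cases h : i = k
  · subst h; simp [selectRows]
  · have h' : l - (i : Fin n) ≠ l - k := fun e => h (Subtype.ext (sub_right_injective e))
    rw [if_neg h]
    refine Finset.sum_eq_zero fun j _ => ?_
    by_cases hj : l - (i : Fin n) = j
    · have : l - (k : Fin n) ≠ j := fun e => h' (hj.trans e.symm)
      simp [selectRows, this]
    · simp [selectRows, hj]

lemma shiftRows_mul_transpose (u : Fin n → ℝ) (i k : S) :
    (shiftRows S u * (shiftRows S u)ᵀ) i k = ∑ j, u j * u (j + (k - i)) := by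
  rw [← Equiv.sum_comp (Equiv.addRight (i : Fin n)), Matrix.mul_apply]
  refine Finset.sum_congr rfl fun j _ => ?_
  simp [shiftRows]

/-- With high probability over the column signs, distinct shifts of the sign-flipped vector are
almost orthogonal. -/
lemma measure_shiftRows_gram_ge_le {x : Fin n → ℝ} (hx : ∑ j, x j ^ 2 = 1) {ρ L : ℝ} (hρ : 0 < ρ)
    (hxρ : ∀ j, |x j| ≤ ρ) (hS : 0 < S.card)
    (hL : 3 * L ≤ 1 / (32 * S.card ^ 2 * ρ ^ 2)) :
    (Measure.pi fun _ : Fin n => rademacher)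
      {ξ | ∃ p : S × S, p.1 ≠ p.2 ∧
        1 / (2 * S.card) ≤ |(shiftRows S (ξ * x) * (shiftRows S (ξ * x))ᵀ) p.1 p.2|} ≤
      ENNReal.ofReal (4 * S.card ^ 2 * Real.exp (-(3 * L))) := by
  have hm : (0 : ℝ) < S.card := by exact_mod_cast hS
  have hpair : ∀ p : S × S, (Measure.pi fun _ : Fin n => rademacher)
      {ξ | p.1 ≠ p.2 ∧
        1 / (2 * S.card) ≤ |(shiftRows S (ξ * x) * (shiftRows S (ξ * x))ᵀ) p.1 p.2|} ≤
      ENNReal.ofReal (4 * Real.exp (-(3 * L))) := by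
    rintro ⟨i, k⟩
    by_cases hik : i = k
    · simp [hik]
    have hd : (k : Fin n) - i ≠ 0 := fun h => hik (Subtype.ext (sub_eq_zero.1 h).symm)
    have h := measure_shift_chaos_ge_le ((k : Fin n) - (i : Fin n)) hd
      (fun j => x j * x (j + ((k : Fin n) - (i : Fin n)))) (ρ ^ 2) (1 / (2 * S.card))
      (by positivity) ?_ (by positivity)
    · refine (measure_mono ?_).trans (h.trans (ENNReal.ofReal_le_ofReal ?_))
      · rintro ξ ⟨-, hξ⟩
        rw [shiftRows_mul_transpose] at hξ
        refine hξ.trans (le_of_eq ?_)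
        congr 1
        refine Finset.sum_congr rfl fun j _ => ?_
        simp only [Pi.mul_apply]
        ring
      · gcongr
        refine hL.trans (le_of_eq ?_)
        field_simp
        norm_num
    · calc ∑ j, (x j * x (j + ((k : Fin n) - (i : Fin n)))) ^ 2 ≤ ∑ j, x j ^ 2 * ρ ^ 2 := by
            refine Finset.sum_le_sum fun j _ => ?_
            rw [mul_pow]
            refine mul_le_mul_of_nonneg_left ?_ (sq_nonneg _)
            rw [← sq_abs]
            exact pow_le_pow_left₀ (abs_nonneg _) (hxρ _) 2
        _ = ρ ^ 2 := by rw [← Finset.sum_mul, hx, one_mul]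
  have hset : {ξ : Fin n → ℝ | ∃ p : S × S, p.1 ≠ p.2 ∧
        1 / (2 * S.card) ≤ |(shiftRows S (ξ * x) * (shiftRows S (ξ * x))ᵀ) p.1 p.2|} =
      ⋃ p : S × S, {ξ | p.1 ≠ p.2 ∧
        1 / (2 * S.card) ≤ |(shiftRows S (ξ * x) * (shiftRows S (ξ * x))ᵀ) p.1 p.2|} := by
    ext ξ; simp only [Set.mem_ofPred_eq, Set.mem_iUnion]
  rw [hset]
  refine (measure_iUnion_fintype_le _ _).trans ((Finset.sum_le_sum fun p _ => hpair p).trans ?_)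
  rw [Finset.sum_const, Finset.card_univ, Fintype.card_prod, Fintype.card_coe, nsmul_eq_mul,
    ← ENNReal.ofReal_natCast, ← ENNReal.ofReal_mul (by positivity)]
  refine ENNReal.ofReal_le_ofReal (le_of_eq ?_)
  push_cast
  ring

/-- The coordinates of `Ãᵀ b` for fixed signs with almost orthogonal shifts. -/
lemma IsOneBitModel.measure_exists_coord_ge_le {Θ : ℝ → ℝ → ℝ} {ν : Measure ℝ}
    (h : IsOneBitModel Θ ν) {x ξ : Fin n → ℝ} (hx : ∑ j, x j ^ 2 = 1)
    (hξ : ∀ j, ξ j = 1 ∨ ξ j = -1) {ρ : ℝ} (hxρ : ∀ j, |x j| ≤ ρ) (hS : 0 < S.card)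
    (hρ : S.card * ρ ≤ 1)
    (hgram : ∀ i k : S, i ≠ k →
      |(shiftRows S (ξ * x) * (shiftRows S (ξ * x))ᵀ) i k| ≤ 1 / (2 * S.card))
    (T : ℝ) (hT : 0 ≤ T) :
    ((Measure.pi fun _ : Fin n => gaussianReal 0 1).prod (Measure.pi fun _ : S => ν))
        {p | ∃ l, 7 * Real.sqrt (S.card * T) ≤
          |((partialCirc S p.1)ᵀ *ᵥ obs S Θ x ξ p.1 p.2) l|} ≤
      ENNReal.ofReal (4 * n * Real.exp (-(2 * T))) := by
  have hm : (0 : ℝ) < S.card := by exact_mod_cast hS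
  have hne : Nonempty S := (Finset.card_pos.1 hS).to_subtype
  have hcard : Fintype.card S = S.card := Fintype.card_coe S
  have hl : ∀ l, ((Measure.pi fun _ : Fin n => gaussianReal 0 1).prod (Measure.pi fun _ : S => ν))
        {p | 7 * Real.sqrt (S.card * T) ≤
          |((partialCirc S p.1)ᵀ *ᵥ obs S Θ x ξ p.1 p.2) l|} ≤
      ENNReal.ofReal (4 * Real.exp (-(2 * T))) := by
    intro l
    have h1 := h.measure_abs_bits_ge_le (shiftRows S (ξ * x)) (selectRows S l) ?_ ?_
      (selectRows_mul_transpose S l) ρ ?_ (by rw [hcard]; exact hρ)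
      (7 * Real.sqrt (S.card * T)) (by positivity)
    · refine le_trans (le_of_eq ?_) (h1.trans (ENNReal.ofReal_le_ofReal ?_))
      · congr 1
        ext p
        simp only [Set.mem_ofPred_eq]
        rw [partialCirc_transpose_mulVec, ← sensing_mulVec_eq]
        rfl
      · gcongr
        -- the factor `7` is chosen so that `7 ^ 2 / 24 ≥ 2`
        rw [hcard, mul_pow, Real.sq_sqrt (by positivity)]
        rw [le_div_iff₀ (by positivity)]
        nlinarith [mul_nonneg hm.le hT]
    · intro i
      rw [shiftRows_mul_transpose, sub_self]
      rw [← hx]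
      refine Finset.sum_congr rfl fun j _ => ?_
      rw [add_zero, ← sq, ← sq_abs, abs_mul_apply_of_sign hξ, sq_abs]
    · rw [hcard]; exact hgram
    · intro i k
      rw [shiftRows_mul_selectRows_transpose, abs_mul_apply_of_sign hξ]
      exact hxρ _
  have hset : {p : (Fin n → ℝ) × (S → ℝ) | ∃ l, 7 * Real.sqrt (S.card * T) ≤
          |((partialCirc S p.1)ᵀ *ᵥ obs S Θ x ξ p.1 p.2) l|} =
      ⋃ l, {p | 7 * Real.sqrt (S.card * T) ≤
          |((partialCirc S p.1)ᵀ *ᵥ obs S Θ x ξ p.1 p.2) l|} := by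
    ext p; simp only [Set.mem_ofPred_eq, Set.mem_iUnion]
  rw [hset]
  refine (measure_iUnion_fintype_le _ _).trans ((Finset.sum_le_sum fun p _ => hl p).trans ?_)
  rw [Finset.sum_const, Finset.card_univ, Fintype.card_fin, nsmul_eq_mul,
    ← ENNReal.ofReal_natCast, ← ENNReal.ofReal_mul (by positivity)]
  refine ENNReal.ofReal_le_ofReal (le_of_eq ?_)
  ring

/-- Under the joint law all coordinates of `Ãᵀ b` are of order `√(m (t + log n))`. -/
lemma IsOneBitModel.jointLaw_exists_coord_ge_le {Θ : ℝ → ℝ → ℝ} {ν : Measure ℝ}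
    (h : IsOneBitModel Θ ν) {x : Fin n → ℝ} (hx : ∑ j, x j ^ 2 = 1) {ρ t : ℝ} (hρ : 0 < ρ)
    (ht : 0 < t) (hxρ : ∀ j, |x j| ≤ ρ) (hS : 0 < S.card) (hSρ : S.card * ρ ≤ 1)
    (hL : 3 * (t + Real.log S.card) ≤ 1 / (32 * S.card ^ 2 * ρ ^ 2)) :
    jointLaw S ν {q | ∃ l, 7 * Real.sqrt (S.card * (t + Real.log n)) ≤
        |((partialCirc S q.2.1)ᵀ *ᵥ obs S Θ x q.1 q.2.1 q.2.2) l|} ≤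
      ENNReal.ofReal (8 * Real.exp (-(2 * t)) / S.card) := by
  have := h.isProbabilityMeasure
  have hm : (0 : ℝ) < S.card := by exact_mod_cast hS
  have hmn : (S.card : ℝ) ≤ n := by
    exact_mod_cast (Finset.card_le_univ S).trans_eq (Fintype.card_fin n)
  have hn : (0 : ℝ) < n := hm.trans_le hmn
  have hn1 : (1 : ℝ) ≤ n := by exact_mod_cast NeZero.one_le
  set B : Set ((Fin n → ℝ) × (Fin n → ℝ) × (S → ℝ)) :=
    {q | ∃ l, 7 * Real.sqrt (S.card * (t + Real.log n)) ≤
      |((partialCirc S q.2.1)ᵀ *ᵥ obs S Θ x q.1 q.2.1 q.2.2) l|} with hB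
  have hBm : MeasurableSet B := by
    rw [hB]
    simp only [Set.ofPred_exists]
    refine MeasurableSet.iUnion fun l => measurableSet_le measurable_const (Measurable.abs ?_)
    have ho := h.measurable_obs S x
    simp_rw [partialCirc_transpose_mulVec, dotProduct, selectRows_mulVec]
    exact Finset.measurable_fun_sum _ fun i _ =>
      ((measurable_pi_apply i).comp ho).mul (by fun_prop)
  set D : Set (Fin n → ℝ) := {ξ | ∃ p : S × S, p.1 ≠ p.2 ∧
    1 / (2 * S.card) ≤ |(shiftRows S (ξ * x) * (shiftRows S (ξ * x))ᵀ) p.1 p.2|} with hD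
  have hDm : MeasurableSet D := by
    rw [hD]
    simp only [Set.ofPred_exists, Set.ofPred_and]
    refine MeasurableSet.iUnion fun p => (MeasurableSet.const _).inter
      (measurableSet_le measurable_const (Measurable.abs ?_))
    simp_rw [shiftRows_mul_transpose, Pi.mul_apply]
    fun_prop
  rw [jointLaw, Measure.prod_apply hBm]
  have hpt : ∀ᵐ ξ ∂(Measure.pi fun _ : Fin n => rademacher),
      ((Measure.pi fun _ : Fin n => gaussianReal 0 1).prod (Measure.pi fun _ : S => ν))
        (Prod.mk ξ ⁻¹' B) ≤
      D.indicator 1 ξ + ENNReal.ofReal (4 * n * Real.exp (-(2 * (t + Real.log n)))) := by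
    filter_upwards [ae_pi_rademacher (Fin n)] with ξ hξ
    -- bad signs are counted by the indicator, for good ones the Gaussian bound applies
    by_cases hξD : ξ ∈ D
    · rw [Set.indicator_of_mem hξD]
      exact prob_le_one.trans le_self_add
    · rw [Set.indicator_of_notMem hξD, zero_add]
      refine h.measure_exists_coord_ge_le S hx hξ hxρ hS hSρ (fun i k hik => ?_) _ ?_
      · by_contra hc
        exact hξD ⟨(i, k), hik, (not_le.1 hc).le⟩
      · have := Real.log_nonneg hn1
        linarith
  refine (lintegral_mono_ae hpt).trans ?_
  rw [lintegral_add_right _ measurable_const, lintegral_indicator_one hDm, lintegral_const,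
    measure_univ, mul_one]
  refine (add_le_add_left (measure_shiftRows_gram_ge_le S hx hρ hxρ hS hL) _).trans ?_
  rw [← ENNReal.ofReal_add (by positivity) (by positivity)]
  refine ENNReal.ofReal_le_ofReal ?_
  have e1 : 4 * (S.card : ℝ) ^ 2 * Real.exp (-(3 * (t + Real.log S.card))) ≤
      4 * Real.exp (-(2 * t)) / S.card := by
    have : Real.exp (-(3 * (t + Real.log S.card))) =
        Real.exp (-(3 * t)) * ((S.card : ℝ) ^ 3)⁻¹ := by
      rw [← Real.exp_log (pow_pos hm 3), ← Real.exp_neg, ← Real.exp_add, Real.log_pow]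
      congr 1
      push_cast
      ring
    rw [this]
    have h2 : Real.exp (-(3 * t)) ≤ Real.exp (-(2 * t)) := Real.exp_le_exp.2 (by linarith)
    calc _ = 4 * Real.exp (-(3 * t)) / S.card := by field_simp
      _ ≤ _ := by gcongr
  have e2 : 4 * (n : ℝ) * Real.exp (-(2 * (t + Real.log n))) ≤
      4 * Real.exp (-(2 * t)) / S.card := by
    have : Real.exp (-(2 * (t + Real.log n))) = Real.exp (-(2 * t)) * ((n : ℝ) ^ 2)⁻¹ := by
      rw [← Real.exp_log (pow_pos hn 2), ← Real.exp_neg, ← Real.exp_add, Real.log_pow]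
      congr 1
      push_cast
      ring
    rw [this]
    calc _ = 4 * Real.exp (-(2 * t)) / n := by field_simp
      _ ≤ _ := by gcongr
  calc _ ≤ 4 * Real.exp (-(2 * t)) / S.card + 4 * Real.exp (-(2 * t)) / S.card := add_le_add e1 e2
    _ = _ := by ring

end

end OneBitCirc

/-! ### The error bound in the supremum norm -/

open OneBitCirc in
theorem lemma1 :
    ∀ K₀ > (0 : ℝ), ∀ K₁ > (0 : ℝ), ∃ C > (0 : ℝ), ∃ c > (0 : ℝ),
      ∀ (n m : ℕ) (S : Finset (Fin n)) (_ : S.card = m)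
        (t : ℝ) (_ : 0 < t) (_ : K₀ * (t + Real.log n) ≤ m)
        -- a unit vector `x` with small sup norm (the norm of `Fin n → ℝ` is the sup norm)
        (x : Fin n → ℝ) (_ : ‖WithLp.toLp 2 x‖ = 1)
        (ρ : ℝ) (_ : ‖x‖ ≤ ρ) (_ : ρ ≤ K₁ / (m * (t + Real.log m)))
        (Θ : ℝ → ℝ → ℝ) (ν : Measure ℝ) (_ : OneBitCirc.IsOneBitModel Θ ν)
        (Ω : Type*) (_ : MeasurableSpace Ω) (P : Measure Ω)
        (ξ g : Ω → Fin n → ℝ) (w : Ω → S → ℝ)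
        (_ : HasLaw (fun ω => (ξ ω, g ω, w ω)) (OneBitCirc.jointLaw S ν) P),
        1 - Real.exp (-(c * t)) - Real.exp (-(c * Real.sqrt m)) ≤
          P.real {ω |
            ‖(1 / (m : ℝ)) • ((OneBitCirc.partialCirc S (g ω))ᵀ *ᵥ
                  OneBitCirc.obs S Θ x (ξ ω) (g ω) (w ω))
                - OneBitCirc.corr Θ ν • (Matrix.diagonal (ξ ω) *ᵥ x)‖
              ≤ C * Real.sqrt ((t + Real.log n) / m)} := by
  intro K₀ hK₀ K₁ hK₁
  -- `log m ≥ L₀` makes `m ρ ≤ 1` and lets the tail bound for the Gram matrix survive the union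
  -- bound; `m ≥ 8` absorbs the factor `8` in front of `exp (-2 t) / m`
  set L₀ : ℝ := 1 + K₁ + 96 * K₁ ^ 2 with hL₀
  have hL₀1 : 1 ≤ L₀ := by rw [hL₀]; nlinarith
  set M₀ : ℝ := 8 + Real.exp L₀ with hM₀
  have hM₀8 : 8 ≤ M₀ := by rw [hM₀]; linarith [Real.exp_pos L₀]
  have hM₀pos : 0 < M₀ * (1 + 1 / K₀) := by positivity
  refine ⟨8, by norm_num, min 2 (Real.log 2 / (M₀ * (1 + 1 / K₀))),
    lt_min (by norm_num) (div_pos (Real.log_pos (by norm_num)) hM₀pos), ?_⟩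
  set c := min 2 (Real.log 2 / (M₀ * (1 + 1 / K₀))) with hc
  have hc0 : 0 < c := lt_min (by norm_num) (div_pos (Real.log_pos (by norm_num)) hM₀pos)
  have hc2 : c * (M₀ * (1 + 1 / K₀)) ≤ Real.log 2 :=
    (le_div_iff₀ hM₀pos).1 (min_le_right _ _)
  intro n m S hSm t ht htm x hx ρ hxρ hρ Θ ν hΘ Ω _ P ξ g w hlaw
  subst hSm
  set m : ℝ := ((S.card : ℕ) : ℝ) with hm
  have hn : NeZero n := ⟨by
    rintro rfl
    have : WithLp.toLp 2 x = 0 := Subsingleton.elim _ _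
    rw [this, norm_zero] at hx
    norm_num at hx⟩
  have hn1 : (1 : ℝ) ≤ n := by exact_mod_cast NeZero.one_le
  have hlogn : 0 ≤ Real.log n := Real.log_nonneg hn1
  have hm0 : 0 < m := lt_of_lt_of_le (by positivity) htm
  have hS : 0 < S.card := Nat.cast_pos.1 hm0
  have hm1 : 1 ≤ m := by rw [hm]; exact_mod_cast hS
  rcases lt_or_ge m M₀ with hmM | hmM
  · -- `m` and hence `t ≤ m / K₀` are bounded, and the claimed probability is not positive
    have half : ∀ y, y ≤ M₀ * (1 + 1 / K₀) → 1 / 2 ≤ Real.exp (-(c * y)) := by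
      intro y hy
      have h1 : c * y ≤ Real.log 2 := (mul_le_mul_of_nonneg_left hy hc0.le).trans hc2
      calc (1 / 2 : ℝ) = Real.exp (-Real.log 2) := by
            rw [Real.exp_neg, Real.exp_log (by norm_num), one_div]
        _ ≤ _ := Real.exp_le_exp.2 (neg_le_neg h1)
    have h1 := half t (by
      have h2 : K₀ * t ≤ M₀ := by nlinarith [mul_nonneg hK₀.le hlogn]
      have h3 : t ≤ M₀ * (1 / K₀) := by
        rw [mul_one_div, le_div_iff₀ hK₀]; linarith
      nlinarith)
    have h2 := half (Real.sqrt m) (by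
      have h3 : Real.sqrt m ≤ m := by
        rw [Real.sqrt_le_left hm0.le]; nlinarith
      have h4 : 0 ≤ M₀ * (1 / K₀) := by positivity
      nlinarith)
    have h3 : 0 ≤ P.real {ω | ‖(1 / m) • ((partialCirc S (g ω))ᵀ *ᵥ obs S Θ x (ξ ω) (g ω) (w ω))
        - corr Θ ν • (Matrix.diagonal (ξ ω) *ᵥ x)‖ ≤ 8 * Real.sqrt ((t + Real.log n) / m)} :=
      measureReal_nonneg
    linarith
  -- the main case: `m` is large
  have hlogm : L₀ ≤ Real.log m := by
    rw [Real.le_log_iff_exp_le hm0]; linarith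
  have hmn : m ≤ n := by
    rw [hm]; exact_mod_cast (Finset.card_le_univ S).trans_eq (Fintype.card_fin n)
  have hlogmn : Real.log m ≤ Real.log n := Real.log_le_log hm0 hmn
  set L := t + Real.log m with hL
  have hLL : L₀ ≤ L := by linarith
  have hL0 : 0 < L := by linarith
  have hxρ' : ∀ j, |x j| ≤ ρ := fun j => (norm_le_pi_norm x j).trans hxρ
  have hx2 : ∑ j, x j ^ 2 = 1 := by
    have := EuclideanSpace.real_norm_sq_eq (WithLp.toLp 2 x)
    rw [hx] at this
    simpa using this.symm
  have hρ0 : 0 < ρ := by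
    refine lt_of_lt_of_le (norm_pos_iff.2 fun h0 => ?_) hxρ
    rw [h0] at hx2
    simp at hx2
  have hmρ : m * ρ * L ≤ K₁ := by
    rw [le_div_iff₀ (by positivity)] at hρ
    linarith
  have hmρ0 : 0 < m * ρ := by positivity
  have hmρ1 : m * ρ ≤ 1 := by
    have h1 : K₁ ≤ L := by nlinarith
    by_contra hcon
    nlinarith
  have hgram : 3 * L ≤ 1 / (32 * m ^ 2 * ρ ^ 2) := by
    rw [le_div_iff₀ (by positivity)]
    have h1 : (m * ρ * L) ^ 2 ≤ K₁ ^ 2 := pow_le_pow_left₀ (by positivity) hmρ 2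
    have h2 : 96 * K₁ ^ 2 ≤ L := by linarith
    have h3 : 96 * (m * ρ * L) ^ 2 ≤ 1 * L := by linarith
    have h4 : 3 * L * (32 * m ^ 2 * ρ ^ 2) * L ≤ 1 * L := by
      calc _ = 96 * (m * ρ * L) ^ 2 := by ring
        _ ≤ _ := h3
    exact le_of_mul_le_mul_right h4 hL0
  have hbad := hΘ.jointLaw_exists_coord_ge_le S hx2 hρ0 ht hxρ' hS hmρ1 hgram
  rw [← hm] at hbad
  have := hΘ.isProbabilityMeasure
  have hJ : IsProbabilityMeasure (jointLaw S ν) := by unfold jointLaw; infer_instance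
  have hP : IsProbabilityMeasure P := hlaw.isProbabilityMeasure_iff.2 hJ
  set B : Set ((Fin n → ℝ) × (Fin n → ℝ) × (S → ℝ)) :=
    {q | ∃ l, 7 * Real.sqrt (m * (t + Real.log n)) ≤
      |((partialCirc S q.2.1)ᵀ *ᵥ obs S Θ x q.1 q.2.1 q.2.2) l|} with hB
  have hsign : ∀ᵐ q ∂(jointLaw S ν), ∀ j, q.1 j = 1 ∨ q.1 j = -1 :=
    Measure.quasiMeasurePreserving_fst.ae (ae_pi_rademacher (Fin n))
  have hsignP : ∀ᵐ ω ∂P, ∀ j, ξ ω j = 1 ∨ ξ ω j = -1 := by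
    rw [← hlaw.map_eq] at hsign
    exact ae_of_ae_map hlaw.aemeasurable hsign
  set X : Ω → (Fin n → ℝ) × (Fin n → ℝ) × (S → ℝ) := fun ω => (ξ ω, g ω, w ω) with hX
  set E : Set Ω := {ω | ‖(1 / m) • ((partialCirc S (g ω))ᵀ *ᵥ obs S Θ x (ξ ω) (g ω) (w ω))
        - corr Θ ν • (Matrix.diagonal (ξ ω) *ᵥ x)‖ ≤ 8 * Real.sqrt ((t + Real.log n) / m)} with hE
  -- off the bad event the sum `Ãᵀ b / m` is small, and so is `λ x̃` because `‖x‖ ≤ ρ ≤ 1 / m`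
  have hsub : Eᶜ ≤ᵐ[P] X ⁻¹' B := by
    filter_upwards [hsignP] with ω hω hωE
    by_contra hωB
    refine hωE ?_
    have hωB' : ∀ l, |((partialCirc S (g ω))ᵀ *ᵥ obs S Θ x (ξ ω) (g ω) (w ω)) l| <
        7 * Real.sqrt (m * (t + Real.log n)) := fun l => not_le.1 fun h => hωB ⟨l, h⟩
    have hT1 : 1 ≤ t + Real.log n := by linarith
    change ‖_‖ ≤ _
    rw [pi_norm_le_iff_of_nonneg (by positivity)]
    intro l
    simp only [Pi.sub_apply, Pi.smul_apply, smul_eq_mul, Matrix.mulVec_diagonal]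
    have e1 : |1 / m * ((partialCirc S (g ω))ᵀ *ᵥ obs S Θ x (ξ ω) (g ω) (w ω)) l| ≤
        7 * Real.sqrt ((t + Real.log n) / m) := by
      rw [abs_mul, abs_of_pos (by positivity : 0 < 1 / m)]
      have h1 : Real.sqrt (m * (t + Real.log n)) = m * Real.sqrt ((t + Real.log n) / m) := by
        rw [show m * (t + Real.log n) = m ^ 2 * ((t + Real.log n) / m) by field_simp,
          Real.sqrt_mul (by positivity), Real.sqrt_sq hm0.le]
      calc _ ≤ 1 / m * (7 * Real.sqrt (m * (t + Real.log n))) := by gcongr; exact (hωB' l).le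
        _ = _ := by rw [h1]; field_simp
    have e2 : |corr Θ ν * (ξ ω l * x l)| ≤ Real.sqrt ((t + Real.log n) / m) := by
      have h1 : |ξ ω l * x l| ≤ ρ := (abs_mul_apply_of_sign hω x l).trans_le (hxρ' l)
      have h2 : ρ ≤ Real.sqrt ((t + Real.log n) / m) := by
        refine Real.le_sqrt_of_sq_le ?_
        rw [le_div_iff₀ hm0]
        have h3 : ρ ≤ m * ρ := le_mul_of_one_le_left hρ0.le hm1
        calc ρ ^ 2 * m = ρ * (m * ρ) := by ring
          _ ≤ 1 * 1 := mul_le_mul (h3.trans hmρ1) hmρ1 hmρ0.le zero_le_one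
          _ ≤ _ := by linarith
      rw [abs_mul]
      calc _ ≤ 1 * ρ := mul_le_mul hΘ.abs_corr_le_one h1 (abs_nonneg _) zero_le_one
        _ ≤ _ := by rw [one_mul]; exact h2
    rw [Real.norm_eq_abs]
    refine (abs_sub _ _).trans ?_
    linarith
  have hPbad : P.real Eᶜ ≤ Real.exp (-(c * t)) := by
    have h1 : P Eᶜ ≤ ENNReal.ofReal (8 * Real.exp (-(2 * t)) / m) := by
      refine (measure_mono_ae hsub).trans ((Measure.le_map_apply hlaw.aemeasurable B).trans ?_)
      rw [hlaw.map_eq]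
      exact hbad
    refine (ENNReal.toReal_le_of_le_ofReal (by positivity) h1).trans ?_
    calc 8 * Real.exp (-(2 * t)) / m ≤ Real.exp (-(2 * t)) := by
          rw [div_le_iff₀ hm0, mul_comm]
          gcongr
          linarith
      _ ≤ _ := Real.exp_le_exp.2 (neg_le_neg
          (mul_le_mul_of_nonneg_right (min_le_left _ _) ht.le))
  have hone : 1 ≤ P.real E + P.real Eᶜ := by
    have := measureReal_union_le (μ := P) E Eᶜ
    rwa [Set.union_compl_self, probReal_univ] at this
  linarith [Real.exp_pos (-(c * Real.sqrt m))]
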